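/- Let $X$ be a metric space that is an absolute Souslin-$\mathcal F$ set, i.e. in the metric completion $\widetilde X$ of $X$ one has $X=\bigcup_{\alpha\in\omega^\omega}\bigcap_{n\in\omega}P_{\alpha\restriction n}$ for some family $(P_s)_{s\in\omega^{<\omega}}$ of closed subsets of $\widetilde X$. Let $Y$ be a metrizable space (not necessarily separable), and let $f\colon X\to Y$ be $\Sigma^0_2$-measurable, i.e. for every open $U\subseteq Y$ the set $f^{-1}(U)$ is a countable union of closed subsets of $X$. Then exactly one of the following holds: (i) $f$ is piecewise continuous, i.e. $X$ can be covered by closed sets $X_0,X_1,X_2,\dots$ such that $f\restriction X_n$ is continuous for every $n$; (ii) $L\sqsubseteq f$ or $L_1\sqsubseteq f$. Here, for functions $g\colon X_0\to Y_0$ and $h\colon X_1\to Y_1$ between topological spaces, $g\sqsubseteq h$ ("$g$ is contained in $h$") means that there are topological embeddings (homeomorphisms onto their images) $\varphi\colon X_0\to X_1$ and $\psi\colon g(X_0)\to Y_1$ such that $\psi\circ g=h\circ\varphi$. Lebesgue's functions $L\colon 2^\omega\to\mathbb R$ and $L_1\colon 2^\omega\to 2^\omega\times\mathbb R$ are defined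 on the Cantor space by $L(z)=\bigl(1+\sum_{i}z(i)2^i\bigr)^{-1}$ if $z$ is eventually equal to $0$, $L(z)=0$ otherwise, and $L_1(z)=(z,L(z))$. -/

import Mathlib

open Set Topology

/-- `A` is a `Σ⁰₂` subset of the topological space `X`: a countable union of closed sets. -/
def IsSigma02 {X : Type*} [TopologicalSpace X] (A : Set X) : Prop :=
  ∃ F : ℕ → Set X, (∀ n, IsClosed (F n)) ∧ A = ⋃ n, F n

/-- `f` is `Σ⁰₂`-measurable: preimages of open sets are `Σ⁰₂`. -/
def Sigma02Measurable {X Y : Type*} [TopologicalSpace X] [TopologicalSpace Y]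
    (f : X → Y) : Prop :=
  ∀ U : Set Y, IsOpen U → IsSigma02 (f ⁻¹' U)

/-- `f` is piecewise continuous: its domain is covered by a sequence of closed sets on each
of which the restriction of `f` is continuous. -/
def PiecewiseContinuous {X Y : Type*} [TopologicalSpace X] [TopologicalSpace Y]
    (f : X → Y) : Prop :=
  ∃ F : ℕ → Set X, (∀ n, IsClosed (F n)) ∧ (⋃ n, F n) = univ ∧ ∀ n, ContinuousOn f (F n)

/-- The Souslin operation applied to a scheme `P` indexed by finite sequences of naturals:
`⋃_α ⋂_n P (α 0, …, α (n - 1))`. -/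
def souslinOperation {Z : Type*} (P : List ℕ → Set Z) : Set Z :=
  ⋃ α : ℕ → ℕ, ⋂ n : ℕ, P ((List.range n).map α)

/-- `A` is a Souslin-`F` subset of `Z`: the result of the Souslin operation on closed sets. -/
def IsSouslinF {Z : Type*} [TopologicalSpace Z] (A : Set Z) : Prop :=
  ∃ P : List ℕ → Set Z, (∀ s, IsClosed (P s)) ∧ A = souslinOperation P

/-- The metric space `X` is an absolute Souslin-`F` set: (the canonical copy of) `X` is a
Souslin-`F` subset of the completion of `X` under its metric. -/
def IsAbsoluteSouslinF (X : Type*) [MetricSpace X] : Prop :=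
  IsSouslinF (range ((↑) : X → UniformSpace.Completion X))

/-- `f` is contained in `g`: there are topological embeddings `φ : X₀ → X₁` and
`ψ : f(X₀) → Y₁` (with `f(X₀)` a subspace of `Y₀`) such that `ψ ∘ f = g ∘ φ`. -/
def FunContained {X₀ Y₀ X₁ Y₁ : Type*} [TopologicalSpace X₀] [TopologicalSpace Y₀]
    [TopologicalSpace X₁] [TopologicalSpace Y₁] (f : X₀ → Y₀) (g : X₁ → Y₁) : Prop :=
  ∃ (φ : X₀ → X₁) (ψ : range f → Y₁), IsEmbedding φ ∧ IsEmbedding ψ ∧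
    ∀ x, ψ ⟨f x, mem_range_self x⟩ = g (φ x)

/-- The points of the Cantor space `2^ω` that are eventually equal to `0`. -/
def eventuallyZero : Set (ℕ → Bool) :=
  {z | ∃ i, ∀ j, i ≤ j → z j = false}

open Classical in
/-- Lebesgue's function `L : 2^ω → ℝ`. It vanishes at the sequences with infinitely many `1`s;
at an eventually zero sequence `z` it is `1 / (1 + ∑ i, z(i) 2^i)`. Thus on the eventually zero
sequences it is positive and injective, and exceeds each `ε > 0` at finitely many points only. -/
noncomputable def lebesgueL (z : ℕ → Bool) : ℝ :=
  if z ∈ eventuallyZero then 1 / (1 + ((∑ᶠ i : ℕ, if z i then 2 ^ i else 0 : ℕ) : ℝ)) else 0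

/-- Lebesgue's function `L₁ : 2^ω → 2^ω × ℝ`, `L₁(z) = (z, L(z))`. -/
noncomputable def lebesgueL₁ (z : ℕ → Bool) : (ℕ → Bool) × ℝ :=
  (z, lebesgueL z)

/-! The proof builds Cantor sets on a tree indexed by `ℕ`. The number `k` stands for the eventually
zero sequence `bitSeq k`. Its children `k + 2 ^ m`, with `k < 2 ^ m`, keep the digits of `k`, add
zeros up to place `m` and put a `1` there. A node carries a point and a set around it, and its
children converge to the point.

First, `f` is reduced to a function on the Cantor space. The sets covered by countably many closed
sets on which `f` is continuous form a σ-ideal, and membership in it is a local property even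
without separability. If `f` is not piecewise continuous, some nonempty set is large in each of its
relatively open parts. By `EverywhereLargeFor.exists_large_oscillation`, `f` then jumps at a point
of its closure by more than some `δ` towards a large set in every neighbourhood. Σ⁰₂-measurability
makes "more than `δ` away" a countable union of closed sets, so a large part can be chosen whose
closure still sees the jump. Iterating inside the Souslin scheme, which keeps limits of branches in
`X`, gives `exists_embedding_hasJumpsAtBitSeq`.

Next comes a dichotomy for a Σ⁰₂-measurable `g` on the Cantor space with a dense set of jumps; by
Baire category its continuity points are dense too. Either on some open set the values of `g` come
arbitrarily close to one fixed `y` in every nonempty open subset, and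
`exists_embedding_of_concentrated` finds a copy of `L`; or any value can be avoided by a positive
distance on a smaller open set, and `exists_embedding_of_separated` finds a copy of `L₁`.

The alternatives exclude each other by Baire category: a function containing `L` or `L₁` and
piecewise continuous would make `L` continuous on a nonempty open set. -/

/-! ### Binary digits and the topology of the Cantor space -/

/-- The number with binary digits `z 0, …, z (m - 1)`, least significant digit first. -/
def truncNat (z : ℕ → Bool) : ℕ → ℕ
  | 0 => 0
  | m + 1 => if z m then truncNat z m + 2 ^ m else truncNat z m

/-- The eventually zero sequence of the binary digits of `k`. -/
def bitSeq (k : ℕ) : ℕ → Bool := fun i => k.testBit i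

theorem truncNat_lt (z : ℕ → Bool) (m : ℕ) : truncNat z m < 2 ^ m := by
  induction m with
  | zero => simp [truncNat]
  | succ m ih => simp only [truncNat, pow_succ]; split_ifs <;> omega

theorem truncNat_succ_of_true {z : ℕ → Bool} {m : ℕ} (h : z m = true) :
    truncNat z (m + 1) = truncNat z m + 2 ^ m := by simp [truncNat, h]

theorem truncNat_succ_of_false {z : ℕ → Bool} {m : ℕ} (h : z m = false) :
    truncNat z (m + 1) = truncNat z m := by simp [truncNat, h]

theorem testBit_truncNat (z : ℕ → Bool) (m i : ℕ) :
    (truncNat z m).testBit i = (decide (i < m) && z i) := by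
  induction m with
  | zero => simp [truncNat]
  | succ m ih =>
    cases hz : z m with
    | false =>
      rw [truncNat_succ_of_false hz, ih]
      rcases lt_trichotomy i m with h | rfl | h
      · simp [h, h.trans (Nat.lt_succ_self m)]
      · simp [hz]
      · simp [h.not_gt, show ¬ i < m + 1 by omega]
    | true =>
      rw [truncNat_succ_of_true hz]
      rcases lt_trichotomy i m with h | rfl | h
      · rw [add_comm, Nat.testBit_two_pow_add_gt h, ih]
        simp [h, h.trans (Nat.lt_succ_self m)]
      · rw [add_comm, Nat.testBit_two_pow_add_eq, ih]
        simp [hz]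
      · have h1 : truncNat z m + 2 ^ m < 2 ^ i := by
          have h2 := truncNat_lt z m
          have h3 : 2 ^ (m + 1) ≤ 2 ^ i := Nat.pow_le_pow_right (by norm_num) h
          rw [pow_succ] at h3
          omega
        rw [Nat.testBit_lt_two_pow h1]
        simp [show ¬ i < m + 1 by omega]

theorem truncNat_eq_iff {z z' : ℕ → Bool} {m : ℕ} :
    truncNat z m = truncNat z' m ↔ ∀ i < m, z i = z' i := by
  constructor
  · intro h i hi
    have := congrArg (fun k => k.testBit i) h
    simpa [testBit_truncNat, hi] using this
  · intro h
    refine Nat.eq_of_testBit_eq fun i => ?_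
    rw [testBit_truncNat, testBit_truncNat]
    by_cases hi : i < m
    · simp [hi, h i hi]
    · simp [hi]

theorem truncNat_bitSeq {k m : ℕ} (h : k < 2 ^ m) : truncNat (bitSeq k) m = k := by
  refine Nat.eq_of_testBit_eq fun i => ?_
  rw [testBit_truncNat]
  by_cases hi : i < m
  · simp [hi, bitSeq]
  · have : k < 2 ^ i := h.trans_le (Nat.pow_le_pow_right (by norm_num) (not_lt.1 hi))
    simp [hi, Nat.testBit_lt_two_pow this]

theorem bitSeq_injective : Function.Injective bitSeq := by
  intro k l h
  exact Nat.eq_of_testBit_eq fun i => congrFun h i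

theorem bitSeq_mem_eventuallyZero (k : ℕ) : bitSeq k ∈ eventuallyZero := by
  refine ⟨k, fun j hj => Nat.testBit_lt_two_pow (Nat.lt_two_pow_self.trans_le ?_)⟩
  exact Nat.pow_le_pow_right (by norm_num) hj

theorem eq_bitSeq_of_forall_false {z : ℕ → Bool} {m : ℕ} (h : ∀ j, m ≤ j → z j = false) :
    z = bitSeq (truncNat z m) := by
  funext i
  rw [bitSeq, testBit_truncNat]
  by_cases hi : i < m
  · simp [hi]
  · simp [hi, h i (not_lt.1 hi)]

theorem exists_eq_bitSeq {z : ℕ → Bool} (h : z ∈ eventuallyZero) : ∃ k, z = bitSeq k := by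
  obtain ⟨m, hm⟩ := h
  exact ⟨_, eq_bitSeq_of_forall_false hm⟩

/-- A sequence either ends with zeros from `m` on, or has a first digit `1` from `m` on. -/
theorem eq_bitSeq_or_exists_next (z : ℕ → Bool) (m : ℕ) :
    z = bitSeq (truncNat z m) ∨
      ∃ m', m ≤ m' ∧ z m' = true ∧ truncNat z m' = truncNat z m := by
  by_cases h : ∀ j, m ≤ j → z j = false
  · exact Or.inl (eq_bitSeq_of_forall_false h)
  · right
    classical
    push Not at h
    have h' : ∃ j, m ≤ j ∧ z j = true := by
      obtain ⟨j, hj, hz⟩ := h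
      exact ⟨j, hj, by simpa using hz⟩
    refine ⟨Nat.find h', (Nat.find_spec h').1, (Nat.find_spec h').2, ?_⟩
    have key : ∀ d, m + d ≤ Nat.find h' → truncNat z (m + d) = truncNat z m := by
      intro d
      induction d with
      | zero => simp
      | succ d ih =>
        intro hd
        have hlt : m + d < Nat.find h' := by omega
        have hz : z (m + d) = false := by
          have := Nat.find_min h' hlt
          simpa using this
        rw [← add_assoc, truncNat_succ_of_false hz]
        exact ih hlt.le
    have := key (Nat.find h' - m) (by have := (Nat.find_spec h').1; omega)
    rwa [Nat.add_sub_cancel' (Nat.find_spec h').1] at this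

theorem exists_true_of_notMem {z : ℕ → Bool} (h : z ∉ eventuallyZero) (m : ℕ) :
    ∃ m', m ≤ m' ∧ z m' = true := by
  by_contra! hc
  exact h ⟨m, fun j hj => by simpa using hc j hj⟩

theorem isOpen_setOf_truncNat_eq (m k : ℕ) : IsOpen {z : ℕ → Bool | truncNat z m = k} := by
  have hc : ∀ m, Continuous fun z : ℕ → Bool => truncNat z m := by
    intro m
    induction m with
    | zero => simpa [truncNat] using continuous_const
    | succ m ih =>
      have h1 : Continuous fun p : Bool × ℕ => if p.1 then p.2 + 2 ^ m else p.2 :=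
        continuous_of_discreteTopology
      exact h1.comp ((continuous_apply m).prodMk ih)
  exact (isOpen_discrete {k}).preimage (hc m)

theorem exists_truncNat_subset_of_mem_nhds {z : ℕ → Bool} {U : Set (ℕ → Bool)} (h : U ∈ 𝓝 z) :
    ∃ m, {z' | truncNat z' m = truncNat z m} ⊆ U := by
  rw [nhds_pi, Filter.mem_pi] at h
  obtain ⟨I, hI, t, ht, hU⟩ := h
  obtain ⟨m, hm⟩ := hI.bddAbove
  refine ⟨m + 1, fun z' hz' => hU fun i hi => ?_⟩
  have := truncNat_eq_iff.1 hz' i (Nat.lt_succ_of_le (hm hi))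
  rw [this]
  exact mem_of_mem_nhds (ht i)

theorem setOf_truncNat_mem_nhds (z : ℕ → Bool) (m : ℕ) :
    {z' | truncNat z' m = truncNat z m} ∈ 𝓝 z :=
  (isOpen_setOf_truncNat_eq m _).mem_nhds rfl

theorem sum_range_eq_truncNat (z : ℕ → Bool) (m : ℕ) :
    ∑ i ∈ Finset.range m, (if z i then 2 ^ i else 0) = truncNat z m := by
  induction m with
  | zero => simp [truncNat]
  | succ m ih => rw [Finset.sum_range_succ, ih]; simp only [truncNat]; split_ifs <;> rfl

theorem lebesgueL_bitSeq (k : ℕ) : lebesgueL (bitSeq k) = 1 / (1 + (k : ℝ)) := by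
  have h : ∑ᶠ i : ℕ, (if bitSeq k i then 2 ^ i else 0) = k := by
    rw [finsum_eq_sum_of_support_subset (s := Finset.range k), sum_range_eq_truncNat,
      truncNat_bitSeq Nat.lt_two_pow_self]
    intro i hi
    by_contra hik
    have : k < 2 ^ i := Nat.lt_two_pow_self.trans_le
      (Nat.pow_le_pow_right (by norm_num) (by simpa using hik))
    simp [bitSeq, Nat.testBit_lt_two_pow this] at hi
  rw [lebesgueL, if_pos (bitSeq_mem_eventuallyZero k), h]

theorem lebesgueL_of_notMem {z : ℕ → Bool} (h : z ∉ eventuallyZero) : lebesgueL z = 0 := by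
  rw [lebesgueL, if_neg h]

/-! ### Recursion along the tree of natural numbers -/

/-- Recursive construction of a family indexed by `ℕ`, seen as the tree in which the children
of `k` are the numbers `k + 2 ^ m` with `k < 2 ^ m`. -/
theorem exists_binary_tree {T : Type*} (Good : T → Prop) (Child : ℕ → T → T → Prop)
    (Sep : T → T → T → Prop) (base : ∃ t, Good t)
    (step : ∀ (m : ℕ) (p : T), Good p → ∀ s : Set T, s.Finite → (∀ j ∈ s, Good j) →
      ∃ t, Good t ∧ Child m p t ∧ ∀ j ∈ s, Sep p j t) :
    ∃ h : ℕ → T, (∀ n, Good (h n)) ∧ ∀ k m, k < 2 ^ m →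
      Child m (h k) (h (k + 2 ^ m)) ∧ ∀ j < k + 2 ^ m, Sep (h k) (h j) (h (k + 2 ^ m)) := by
  classical
  obtain ⟨t₀, ht₀⟩ := base
  let Next : ℕ → (ℕ → T) → T → Prop := fun n h t => Good t ∧ ∀ k m, k < 2 ^ m → n = k + 2 ^ m →
      Child m (h k) t ∧ ∀ j < n, Sep (h k) (h j) t
  have hNext : ∀ n h, (∀ j < n, Good (h j)) → ∃ t, Next n h t := by
    intro n h hh
    by_cases hn : ∃ k m, k < 2 ^ m ∧ n = k + 2 ^ m
    · obtain ⟨k, m, hk, hn⟩ := hn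
      have hkn : k < n := by have : 0 < 2 ^ m := by positivity
                             omega
      obtain ⟨t, h1, h2, h3⟩ := step m (h k) (hh k hkn) (h '' Iio n) ((finite_Iio n).image h)
        (by rintro _ ⟨j, hj, rfl⟩; exact hh j hj)
      refine ⟨t, h1, fun k' m' hk' hn' => ?_⟩
      -- Each `n > 0` has exactly one parent: `2 ^ m` is its leading binary digit.
      have hm : m' = m := by
        have e1 : Nat.log 2 n = m := by
          rw [Nat.log_eq_iff (Or.inr ⟨by norm_num, by omega⟩), pow_succ]; omega
        have e2 : Nat.log 2 n = m' := by
          rw [Nat.log_eq_iff (Or.inr ⟨by norm_num, by omega⟩), pow_succ]; omega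
        omega
      subst hm
      have : k' = k := by omega
      subst this
      exact ⟨h2, fun j hj => h3 _ ⟨j, hj, rfl⟩⟩
    · exact ⟨t₀, ht₀, fun k m hk e => (hn ⟨k, m, hk, e⟩).elim⟩
  let F : ℕ → (ℕ → T) → T := fun n h => if H : ∃ t, Next n h t then H.choose else t₀
  let H : ℕ → ℕ → T := fun n => Nat.rec (fun _ => t₀) (fun n h => Function.update h n (F n h)) n
  have hHs : ∀ n, H (n + 1) = Function.update (H n) n (F n (H n)) := fun n => rfl
  have hH : ∀ n j, j < n → H n j = H (j + 1) j := by
    intro n j hj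
    induction n with
    | zero => omega
    | succ n ih =>
      rcases Nat.lt_succ_iff_lt_or_eq.1 hj with h | rfl
      · rw [hHs, Function.update_of_ne h.ne, ih h]
      · rfl
  have hgood : ∀ n, Next n (H n) (H (n + 1) n) := by
    intro n
    induction n using Nat.strong_induction_on with
    | _ n ih =>
      have hex : ∃ t, Next n (H n) t := hNext n (H n) fun j hj => by
        rw [hH n j hj]; exact (ih j hj).1
      rw [hHs, Function.update_self]
      simp only [F, dif_pos hex]
      exact hex.choose_spec
  refine ⟨fun n => H (n + 1) n, fun n => (hgood n).1, fun k m hk => ?_⟩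
  have hkn : k < k + 2 ^ m := by have : 0 < 2 ^ m := by positivity
                                 omega
  obtain ⟨h1, h2⟩ := (hgood (k + 2 ^ m)).2 k m hk rfl
  rw [hH _ k hkn] at h1 h2
  refine ⟨h1, fun j hj => ?_⟩
  have := h2 j hj
  rwa [hH _ j hj] at this

/-! ### Cantor schemes -/

section Scheme

variable {X : Type*} [MetricSpace X] {x : ℕ → X} {F : ℕ → Set X}

/-- A system of sets indexed by the tree of `exists_binary_tree` yields an embedding of the
Cantor space. -/
theorem exists_embedding_of_scheme (hx : ∀ k, x k ∈ F k)
    (hsub : ∀ k m, k < 2 ^ m → F (k + 2 ^ m) ⊆ F k)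
    (hball : ∀ k m, k < 2 ^ m → F (k + 2 ^ m) ⊆ Metric.closedBall (x k) ((1 / 2) ^ m))
    (hnot : ∀ k m, k < 2 ^ m → x k ∉ F (k + 2 ^ m))
    (hdisj : ∀ k m m', k < 2 ^ m → m < m' → Disjoint (F (k + 2 ^ m)) (F (k + 2 ^ m')))
    (hne : ∀ z ∉ eventuallyZero, (⋂ m, F (truncNat z m)).Nonempty) :
    ∃ φ : (ℕ → Bool) → X, IsEmbedding φ ∧ (∀ k, φ (bitSeq k) = x k) ∧
      ∀ z m, φ z ∈ F (truncNat z m) := by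
  classical
  have hanti : ∀ z m d, F (truncNat z (m + d)) ⊆ F (truncNat z m) := by
    intro z m d
    induction d with
    | zero => rfl
    | succ d ih =>
      refine Subset.trans ?_ ih
      rw [← add_assoc]
      cases hz : z (m + d) with
      | false => rw [truncNat_succ_of_false hz]
      | true => rw [truncNat_succ_of_true hz]; exact hsub _ _ (truncNat_lt _ _)
  have hex : ∀ z, ∃ p, (∀ m, p ∈ F (truncNat z m)) ∧ ∀ k, z = bitSeq k → p = x k := by
    intro z
    by_cases hz : z ∈ eventuallyZero
    · obtain ⟨k, rfl⟩ := exists_eq_bitSeq hz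
      refine ⟨x k, fun m => ?_, fun l hl => by rw [bitSeq_injective hl]⟩
      have := hanti (bitSeq k) m k
      rw [truncNat_bitSeq (Nat.lt_two_pow_self.trans_le
        (Nat.pow_le_pow_right (by norm_num) (by omega)))] at this
      exact this (hx k)
    · obtain ⟨p, hp⟩ := hne z hz
      exact ⟨p, mem_iInter.1 hp, fun k hk => (hz (hk ▸ bitSeq_mem_eventuallyZero k)).elim⟩
  choose φ hφ hφq using hex
  have hφq' : ∀ k, φ (bitSeq k) = x k := fun k => hφq _ k rfl
  -- A digit `0` does not change the node, so the set at stage `m` need not be small. The estimate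
  -- comes from the next digit `1`, or from `φ z` being the node's own point.
  have hcl : ∀ z m, φ z ∈ Metric.closedBall (x (truncNat z m)) ((1 / 2) ^ m) := by
    intro z m
    rcases eq_bitSeq_or_exists_next z m with h | ⟨m', hm', hz, ht⟩
    · rw [hφq _ _ h]; exact Metric.mem_closedBall_self (by positivity)
    · have h1 := hφ z (m' + 1)
      rw [truncNat_succ_of_true hz] at h1
      have h2 := hball _ _ (truncNat_lt z m') h1
      rw [ht] at h2
      exact Metric.closedBall_subset_closedBall
        (pow_le_pow_of_le_one (by norm_num) (by norm_num) hm') h2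
  refine ⟨φ, ?_, hφq', hφ⟩
  have hcont : Continuous φ := by
    rw [continuous_iff_continuousAt]
    intro z
    rw [Metric.continuousAt_iff']
    intro ε hε
    obtain ⟨m, hm⟩ := exists_pow_lt_of_lt_one (show 0 < ε / 2 by positivity)
      (show (1 / 2 : ℝ) < 1 by norm_num)
    filter_upwards [setOf_truncNat_mem_nhds z m] with z' hz'
    have h1 := hcl z m
    have h2 := hcl z' m
    rw [hz'] at h2
    rw [Metric.mem_closedBall] at h1 h2
    calc dist (φ z') (φ z) ≤ dist (φ z') (x (truncNat z m)) + dist (φ z) (x (truncNat z m)) :=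
          dist_triangle_right _ _ _
      _ < ε := by linarith
  -- At the first differing digit one sequence enters the child at `m`, while the other enters a
  -- later child or stays at the point of the node forever.
  have hne' : ∀ z z' m, truncNat z m = truncNat z' m → z m = true → z' m = false →
      φ z ≠ φ z' := by
    intro z z' m ht h1 h0 he
    have hz := hφ z (m + 1)
    rw [truncNat_succ_of_true h1] at hz
    rcases eq_bitSeq_or_exists_next z' m with h | ⟨m', hm', hz', ht'⟩
    · rw [he, hφq _ _ h, ← ht] at hz
      exact hnot _ _ (truncNat_lt _ _) hz
    · have h2 := hφ z' (m' + 1)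
      rw [truncNat_succ_of_true hz', ht', ← ht] at h2
      have hlt : m < m' := lt_of_le_of_ne hm' (by rintro rfl; simp [h0] at hz')
      exact disjoint_left.1 (hdisj _ _ _ (truncNat_lt _ _) hlt) hz (he ▸ h2)
  have hinj : Function.Injective φ := by
    intro z z' he
    by_contra hzz
    have hd : ∃ i, z i ≠ z' i := Function.ne_iff.1 hzz
    have ht : truncNat z (Nat.find hd) = truncNat z' (Nat.find hd) :=
      truncNat_eq_iff.2 fun i hi => not_not.1 (Nat.find_min hd hi)
    have hs := Nat.find_spec hd
    cases h1 : z (Nat.find hd) with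
    | true =>
      exact hne' z z' _ ht h1 (by rw [h1] at hs; simpa using hs.symm) he
    | false =>
      exact hne' z' z _ ht.symm (by rw [h1] at hs; simpa using hs.symm) h1 he.symm
  exact (hcont.isClosedEmbedding hinj).isEmbedding

end Scheme

/-! ### The σ-ideal of small sets -/

section Ideal

variable {X Y : Type*} [MetricSpace X] [MetricSpace Y]

/-- The set `B` is covered by countably many closed sets on which `f` is continuous. -/
def SmallFor (f : X → Y) (B : Set X) : Prop :=
  ∃ C : ℕ → Set X, (∀ n, IsClosed (C n)) ∧ (∀ n, ContinuousOn f (C n)) ∧ B ⊆ ⋃ n, C n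

variable {f : X → Y}

theorem SmallFor.mono {A B : Set X} (hB : SmallFor f B) (h : A ⊆ B) : SmallFor f A := by
  obtain ⟨C, h1, h2, h3⟩ := hB
  exact ⟨C, h1, h2, h.trans h3⟩

theorem SmallFor.iUnion {B : ℕ → Set X} (h : ∀ n, SmallFor f (B n)) :
    SmallFor f (⋃ n, B n) := by
  choose C h1 h2 h3 using h
  refine ⟨fun n => C n.unpair.1 n.unpair.2, fun n => h1 _ _, fun n => h2 _ _,
    iUnion_subset fun n x hx => ?_⟩
  obtain ⟨k, hk⟩ := mem_iUnion.1 (h3 n hx)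
  exact mem_iUnion.2 ⟨Nat.pair n k, by simpa using hk⟩

theorem SmallFor.union {A B : Set X} (hA : SmallFor f A) (hB : SmallFor f B) :
    SmallFor f (A ∪ B) := by
  refine (SmallFor.iUnion (B := fun n => if n = 0 then A else B) fun n => ?_).mono ?_
  · split_ifs <;> assumption
  · rintro x (hx | hx)
    · exact mem_iUnion.2 ⟨0, by simpa using hx⟩
    · exact mem_iUnion.2 ⟨1, by simpa using hx⟩

theorem smallFor_of_isClosed_of_continuousOn {C : Set X} (hC : IsClosed C)
    (hf : ContinuousOn f C) : SmallFor f C :=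
  ⟨fun _ => C, fun _ => hC, fun _ => hf, fun _ hx => mem_iUnion.2 ⟨0, hx⟩⟩

theorem exists_not_smallFor_of_subset_iUnion {B : Set X} (hB : ¬ SmallFor f B)
    {E : ℕ → Set X} (h : B ⊆ ⋃ n, E n) : ∃ n, ¬ SmallFor f (B ∩ E n) := by
  by_contra! hc
  refine hB ((SmallFor.iUnion hc).mono fun x hx => ?_)
  obtain ⟨n, hn⟩ := mem_iUnion.1 (h hx)
  exact mem_iUnion.2 ⟨n, hx, hn⟩

theorem piecewiseContinuous_iff_smallFor_univ : PiecewiseContinuous f ↔ SmallFor f univ := by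
  constructor
  · rintro ⟨F, h1, h2, h3⟩
    exact ⟨F, h1, h3, h2.ge⟩
  · rintro ⟨F, h1, h2, h3⟩
    exact ⟨F, h1, univ_subset_iff.1 h3, h2⟩

theorem locallyFinite_of_separated {X ι : Type*} [PseudoMetricSpace X] {A : ι → Set X} {r : ℝ}
    (hr : 0 < r) (h : ∀ i j, i ≠ j → ∀ x ∈ A i, ∀ y ∈ A j, r ≤ dist x y) : LocallyFinite A := by
  intro x
  refine ⟨Metric.ball x (r / 2), Metric.ball_mem_nhds x (by positivity),
    Set.Subsingleton.finite ?_⟩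
  rintro i ⟨y, hy, hyx⟩ j ⟨z, hz, hzx⟩
  by_contra hij
  have h1 := h i j hij y hy z hz
  rw [Metric.mem_ball] at hyx hzx
  have := dist_triangle_right y z x
  linarith

/-- Every family of open sets in a metric space has a refinement, with the same union, into
countably many uniformly separated families of closed sets. -/
theorem exists_sigma_separated_refinement {X ι : Type*} [PseudoMetricSpace X] (U : ι → Set X)
    (hU : ∀ i, IsOpen (U i)) :
    ∃ S : ℕ → ι → Set X, (∀ n i, IsClosed (S n i)) ∧ (∀ n i, S n i ⊆ U i) ∧
      (⋃ i, U i) ⊆ (⋃ n, ⋃ i, S n i) ∧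
      ∀ n i j, i ≠ j → ∀ x ∈ S n i, ∀ y ∈ S n j, (1 / 2 : ℝ) ^ n ≤ dist x y := by
  classical
  let r : ι → ι → Prop := WellOrderingRel
  have hwf : WellFounded r := IsWellFounded.wf
  -- Stone's construction: well-order the indices and assign each point to the first `U i`
  -- containing it, provided that its `(1/2) ^ n`-ball also fits into `U i`.
  let S : ℕ → ι → Set X := fun n i =>
    {x | Metric.ball x ((1 / 2) ^ n) ⊆ U i} ∩ ⋂ j, ⋂ (_ : r j i), (U j)ᶜ
  have hclosed : ∀ n i, IsClosed {x | Metric.ball x ((1 / 2 : ℝ) ^ n) ⊆ U i} := by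
    intro n i
    rw [← isOpen_compl_iff, Metric.isOpen_iff]
    intro x hx
    obtain ⟨y, hy, hyU⟩ := not_subset.1 hx
    rw [Metric.mem_ball] at hy
    refine ⟨(1 / 2) ^ n - dist y x, by linarith, fun z hz hzs => hyU (hzs ?_)⟩
    rw [Metric.mem_ball] at hz ⊢
    have := dist_triangle_right y z x
    linarith
  refine ⟨S, fun n i => (hclosed n i).inter ?_, ?_, ?_, ?_⟩
  · exact isClosed_iInter fun j => isClosed_iInter fun _ => (hU j).isClosed_compl
  · rintro n i x ⟨hx, -⟩
    exact hx (Metric.mem_ball_self (by positivity))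
  · intro x hx
    have hne : {i | x ∈ U i}.Nonempty := by
      obtain ⟨i, hi⟩ := mem_iUnion.1 hx
      exact ⟨i, hi⟩
    have hmin := hwf.min_mem {i | x ∈ U i} hne
    obtain ⟨ε, hε, hb⟩ := Metric.isOpen_iff.1 (hU _) x hmin
    obtain ⟨n, hn⟩ := exists_pow_lt_of_lt_one hε (show (1 / 2 : ℝ) < 1 by norm_num)
    refine mem_iUnion.2 ⟨n, mem_iUnion.2 ⟨_, (Metric.ball_subset_ball hn.le).trans hb, ?_⟩⟩
    refine mem_iInter.2 fun j => mem_iInter.2 fun hj hxj => ?_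
    exact hwf.not_lt_min {i | x ∈ U i} hxj hj
  · have key : ∀ n i j, r i j → ∀ x ∈ S n i, ∀ y ∈ S n j, (1 / 2 : ℝ) ^ n ≤ dist x y := by
      intro n i j hij x hx y hy
      by_contra! hlt
      exact mem_iInter.1 (mem_iInter.1 hy.2 i) hij (hx.1 (by rwa [Metric.mem_ball, dist_comm]))
    intro n i j hij x hx y hy
    rcases trichotomous_of r i j with h | h | h
    · exact key n i j h x hx y hy
    · exact (hij h).elim
    · rw [dist_comm]; exact key n j i h y hy x hx

/-- The index type may be uncountable. On a uniformly separated family the `k`-th closed pieces are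
locally finite, so their union is closed and `f` is continuous on it; countably many such unions
suffice. -/
theorem SmallFor.of_iUnion_isOpen {ι : Type*} {U : ι → Set X} {B : Set X}
    (hU : ∀ i, IsOpen (U i)) (h : ∀ i, SmallFor f (U i ∩ B)) :
    SmallFor f ((⋃ i, U i) ∩ B) := by
  obtain ⟨S, hS, hSU, hcov, hsep⟩ := exists_sigma_separated_refinement U hU
  choose C hC hf hcC using h
  refine (SmallFor.iUnion (B := fun n => ⋃ k, ⋃ i, C i k ∩ S n i) fun n =>
    SmallFor.iUnion fun k => ?_).mono ?_
  · have hlf : LocallyFinite fun i => C i k ∩ S n i :=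
      locallyFinite_of_separated (r := (1 / 2) ^ n) (by positivity) fun i j hij x hx y hy =>
        hsep n i j hij x hx.2 y hy.2
    exact smallFor_of_isClosed_of_continuousOn
      (hlf.isClosed_iUnion fun i => (hC i k).inter (hS n i))
      (hlf.continuousOn_iUnion (fun i => (hC i k).inter (hS n i))
        fun i => (hf i k).mono inter_subset_left)
  · rintro x ⟨hxU, hxB⟩
    obtain ⟨n, hn⟩ := mem_iUnion.1 (hcov hxU)
    obtain ⟨i, hi⟩ := mem_iUnion.1 hn
    obtain ⟨k, hk⟩ := mem_iUnion.1 (hcC i ⟨hSU n i hi, hxB⟩)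
    exact mem_iUnion.2 ⟨n, mem_iUnion.2 ⟨k, mem_iUnion.2 ⟨i, hk, hi⟩⟩⟩

/-- No nonempty relatively open subset of `B` is small for `f`. -/
def EverywhereLargeFor (f : X → Y) (B : Set X) : Prop :=
  ∀ U : Set X, IsOpen U → (U ∩ B).Nonempty → ¬ SmallFor f (U ∩ B)

/-- Remove from `B` all open sets with small trace on it. Their union has small trace as well, so
what remains is nonempty and has no small relatively open part. -/
theorem exists_everywhereLargeFor_subset {B : Set X} (hB : ¬ SmallFor f B) :
    ∃ B' ⊆ B, B'.Nonempty ∧ EverywhereLargeFor f B' := by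
  let W : Set X := ⋃ U : {U : Set X // IsOpen U ∧ SmallFor f (U ∩ B)}, U.1
  have hW : SmallFor f (W ∩ B) := SmallFor.of_iUnion_isOpen (fun U => U.2.1) fun U => U.2.2
  refine ⟨B \ W, sdiff_subset, ?_, fun U hU hne hsm => ?_⟩
  · by_contra he
    rw [not_nonempty_iff_eq_empty, sdiff_eq_empty] at he
    exact hB (hW.mono fun x hx => ⟨he hx, hx⟩)
  · have h1 : SmallFor f (U ∩ B) := by
      refine (hsm.union hW).mono fun x hx => ?_
      by_cases hxW : x ∈ W
      · exact Or.inr ⟨hxW, hx.2⟩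
      · exact Or.inl ⟨hx.1, hx.2, hxW⟩
    obtain ⟨x, hxU, hxB, hxW⟩ := hne
    exact hxW (mem_iUnion.2 ⟨⟨U, hU, h1⟩, hxU⟩)

/-- Otherwise `f` is continuous on `closure B`, and `B` is small. Indeed, for `y` near `x` in the
closure, the points of `B` near both have values close to `f x` and close to `f y`, up to two small
sets. Largeness leaves a common `z`, which puts `f y` close to `f x`. -/
theorem EverywhereLargeFor.exists_large_oscillation {B : Set X} (hB : EverywhereLargeFor f B)
    (hne : B.Nonempty) : ∃ x ∈ closure B, ∃ δ > 0, ∀ U : Set X, IsOpen U → x ∈ U →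
      ¬ SmallFor f ((U ∩ B) ∩ {z | δ < dist (f z) (f x)}) := by
  by_contra! hc
  have hcont : ContinuousOn f (closure B) := by
    intro x hx
    rw [Metric.continuousWithinAt_iff']
    intro ε hε
    obtain ⟨U, hU, hxU, hsm⟩ := hc x hx (ε / 3) (by positivity)
    filter_upwards [mem_nhdsWithin_of_mem_nhds (hU.mem_nhds hxU), self_mem_nhdsWithin]
      with y hyU hy
    obtain ⟨V, hV, hyV, hsm'⟩ := hc y hy (ε / 3) (by positivity)
    have hn : ((U ∩ V) ∩ B).Nonempty := mem_closure_iff.1 hy _ (hU.inter hV) ⟨hyU, hyV⟩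
    have hl := hB _ (hU.inter hV) hn
    by_contra hlt
    refine hl ((hsm.union hsm').mono fun z hz => ?_)
    by_contra hz'
    simp only [mem_union, mem_inter_iff, mem_ofPred_eq, not_or, not_and, not_lt] at hz'
    have h1 := hz'.1 ⟨hz.1.1, hz.2⟩
    have h2 := hz'.2 ⟨hz.1.2, hz.2⟩
    have := dist_triangle_left (f y) (f x) (f z)
    linarith
  refine hB univ isOpen_univ (by simpa using hne) ?_
  exact (smallFor_of_isClosed_of_continuousOn isClosed_closure hcont).mono
    (inter_subset_right.trans subset_closure)

end Ideal

/-! ### A Cantor set with a dense set of jumps -/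

section Souslin

variable {X Y : Type*} [MetricSpace X] [MetricSpace Y]

/-- The points of `X` which the Souslin operation on `P` yields along a sequence that agrees
with `α` below `l`. -/
def souslinPiece (P : List ℕ → Set (UniformSpace.Completion X)) (α : ℕ → ℕ) (l : ℕ) : Set X :=
  {x | ∃ β : ℕ → ℕ, (∀ i < l, β i = α i) ∧
    ∀ n, (x : UniformSpace.Completion X) ∈ P ((List.range n).map β)}

theorem souslinPiece_subset_iUnion (P : List ℕ → Set (UniformSpace.Completion X)) (α : ℕ → ℕ)
    (l : ℕ) : souslinPiece P α l ⊆ ⋃ a, souslinPiece P (Function.update α l a) (l + 1) := by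
  rintro x ⟨β, hβ, hx⟩
  refine mem_iUnion.2 ⟨β l, β, fun i hi => ?_, hx⟩
  rcases Nat.lt_succ_iff_lt_or_eq.1 hi with h | rfl
  · rw [Function.update_of_ne h.ne, hβ i h]
  · rw [Function.update_self]

/-- A node of the tree of large sets that is used to find a copy of the Cantor space on which
`f` has a dense set of jumps. -/
structure LargeNode (X : Type*) where
  /-- the large set -/
  carrier : Set X
  /-- the branch of the Souslin scheme, of which only the values below `level` matter -/
  branch : ℕ → ℕ
  /-- the level reached in the Souslin scheme -/
  level : ℕ
  /-- the point at which `f` jumps -/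
  point : X
  /-- the size of the jump -/
  jump : ℝ

/-- The requirements on a single node. -/
structure LargeNode.Good (P : List ℕ → Set (UniformSpace.Completion X)) (f : X → Y)
    (t : LargeNode X) : Prop where
  subset_piece : t.carrier ⊆ souslinPiece P t.branch t.level
  nonempty : t.carrier.Nonempty
  mem_closure : t.point ∈ closure t.carrier
  jump_pos : 0 < t.jump
  large : ∀ U : Set X, IsOpen U → t.point ∈ U →
    ¬ SmallFor f ((U ∩ t.carrier) ∩ {z | t.jump < dist (f z) (f t.point)})

theorem LargeNode.exists_good {P : List ℕ → Set (UniformSpace.Completion X)} {f : X → Y}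
    {B : Set X} (hB : ¬ SmallFor f B) {α : ℕ → ℕ} {l : ℕ} (h : B ⊆ souslinPiece P α l) :
    ∃ t : LargeNode X, t.Good P f ∧ t.carrier ⊆ B ∧ t.branch = α ∧ t.level = l := by
  obtain ⟨B', hB', hne, hl⟩ := exists_everywhereLargeFor_subset hB
  obtain ⟨x, hx, δ, hδ, hU⟩ := hl.exists_large_oscillation hne
  exact ⟨⟨B', α, l, x, δ⟩, ⟨hB'.trans h, hne, hx, hδ, hU⟩, hB', rfl, rfl⟩

/-- The requirements on a node `t` as a child of `p`. -/
structure LargeNode.Child (f : X → Y) (m : ℕ) (p t : LargeNode X) : Prop where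
  subset : t.carrier ⊆ p.carrier
  closure_subset : closure t.carrier ⊆ Metric.closedBall p.point ((1 / 2) ^ m)
  lt_dist : ∀ z ∈ closure t.carrier, p.jump < dist (f z) (f p.point)
  level_eq : t.level = p.level + 1
  branch_eq : ∀ i < p.level, t.branch i = p.branch i

/-- Largeness survives passing to one member of a countable cover. This is used twice: for one of
the closed pieces of the Σ⁰₂ set of points with far values, so that the jump bound extends to the
closure, and for one continuation of the Souslin branch. -/
theorem LargeNode.exists_child {P : List ℕ → Set (UniformSpace.Completion X)} {f : X → Y}
    (hf : Sigma02Measurable f) (m : ℕ) {p : LargeNode X} (hp : p.Good P f)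
    {s : Set (LargeNode X)} (hs : s.Finite) :
    ∃ t : LargeNode X, t.Good P f ∧ LargeNode.Child f m p t ∧
      ∀ j ∈ s, p.point ∉ closure j.carrier → Disjoint (closure j.carrier) (closure t.carrier) := by
  -- The child stays in a neighbourhood of the parent's point that misses all earlier closures not
  -- containing that point, in particular those of its older siblings.
  let V : Set X := ⋂ j ∈ {j ∈ s | p.point ∉ closure j.carrier}, (closure j.carrier)ᶜ
  have hV : V ∈ 𝓝 p.point :=
    (Filter.biInter_mem (hs.subset (sep_subset _ _))).2 fun j hj =>
      isClosed_closure.isOpen_compl.mem_nhds hj.2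
  obtain ⟨ρ, hρ, hρV⟩ := Metric.nhds_basis_closedBall.mem_iff.1 hV
  have hr : 0 < min ρ ((1 / 2) ^ m) := lt_min hρ (by positivity)
  have hopen : IsOpen {y | p.jump < dist y (f p.point)} :=
    isOpen_lt continuous_const (continuous_id.dist continuous_const)
  obtain ⟨E, hE, hfE⟩ := hf _ hopen
  have h1 := hp.large _ Metric.isOpen_ball (Metric.mem_ball_self hr)
  obtain ⟨n, hn⟩ := exists_not_smallFor_of_subset_iUnion h1 (E := E)
    (by rw [← hfE]; exact inter_subset_right)
  obtain ⟨a, ha⟩ := exists_not_smallFor_of_subset_iUnion hn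
    (E := fun a => souslinPiece P (Function.update p.branch p.level a) (p.level + 1))
    ((inter_subset_left.trans (inter_subset_left.trans inter_subset_right)).trans
      (hp.subset_piece.trans (souslinPiece_subset_iUnion _ _ _)))
  obtain ⟨t, ht, htB, hbr, hlv⟩ := LargeNode.exists_good ha inter_subset_right
  have hball : closure t.carrier ⊆ Metric.closedBall p.point (min ρ ((1 / 2) ^ m)) :=
    closure_minimal (fun z hz => Metric.ball_subset_closedBall (htB hz).1.1.1.1)
      Metric.isClosed_closedBall
  refine ⟨t, ht, ⟨fun z hz => (htB hz).1.1.1.2,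
    hball.trans (Metric.closedBall_subset_closedBall (min_le_right _ _)), fun z hz => ?_, hlv,
    fun i hi => by rw [hbr, Function.update_of_ne hi.ne]⟩, fun j hj hpj => ?_⟩
  · have hzE : z ∈ E n := closure_minimal (fun z hz => (htB hz).1.2) (hE n) hz
    have : z ∈ f ⁻¹' {y | p.jump < dist y (f p.point)} := hfE ▸ mem_iUnion.2 ⟨n, hzE⟩
    exact this
  · refine disjoint_right.2 fun z hz => ?_
    have hzV := hρV (Metric.closedBall_subset_closedBall (min_le_left _ _) (hball hz))
    exact mem_iInter₂.1 hzV j ⟨hj, hpj⟩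

/-- `X` need not be complete. Points chosen from the nodes converge in the completion; the coherent
Souslin branches define one infinite branch, and closedness of the sets `P s` places the limit in
the Souslin set, hence in `X`. -/
theorem exists_mem_iInter_closure_of_souslin {P : List ℕ → Set (UniformSpace.Completion X)}
    (hP : ∀ s, IsClosed (P s)) (hX : range ((↑) : X → UniformSpace.Completion X) =
      souslinOperation P) {t : ℕ → LargeNode X}
    (hpiece : ∀ m, (t m).carrier ⊆ souslinPiece P (t m).branch (t m).level)
    (hne : ∀ m, (t m).carrier.Nonempty) (hanti : Antitone fun m => (t m).carrier)
    (hlevel : ∀ N, ∃ m, N ≤ (t m).level)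
    (hbranch : ∀ m m', m ≤ m' → (t m).level ≤ (t m').level ∧
      ∀ i < (t m).level, (t m').branch i = (t m).branch i)
    (hdiam : ∀ ε > 0, ∃ m c, (t m).carrier ⊆ Metric.closedBall c ε) :
    (⋂ m, closure (t m).carrier).Nonempty := by
  choose b hb using hne
  have hcau : CauchySeq b := by
    rw [Metric.cauchySeq_iff']
    intro ε hε
    obtain ⟨m, c, hc⟩ := hdiam (ε / 3) (by positivity)
    refine ⟨m, fun n hn => ?_⟩
    have h1 := hc (hanti hn (hb n))
    have h2 := hc (hb m)
    rw [Metric.mem_closedBall] at h1 h2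
    have := dist_triangle_right (b n) (b m) c
    linarith
  have hcau' : CauchySeq fun n => (b n : UniformSpace.Completion X) :=
    (UniformSpace.Completion.uniformContinuous_coe X).comp_cauchySeq hcau
  obtain ⟨y, hy⟩ := cauchySeq_tendsto_of_complete hcau'
  choose M hM using fun i => hlevel (i + 1)
  have hα : ∀ m, ∀ i < (t m).level, (t m).branch i = (t (M i)).branch i := by
    intro m i hi
    rw [← (hbranch m (max m (M i)) (le_max_left _ _)).2 i hi,
      ← (hbranch (M i) (max m (M i)) (le_max_right _ _)).2 i (hM i)]
  have hyX : y ∈ range ((↑) : X → UniformSpace.Completion X) := by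
    rw [hX]
    refine mem_iUnion.2 ⟨fun i => (t (M i)).branch i, mem_iInter.2 fun n => ?_⟩
    obtain ⟨m, hm⟩ := hlevel n
    refine (hP _).mem_of_tendsto hy ?_
    filter_upwards [Filter.eventually_ge_atTop m] with m' hm'
    obtain ⟨β, hβ, hβP⟩ := hpiece m' (hb m')
    have he : (List.range n).map (fun i => (t (M i)).branch i) = (List.range n).map β := by
      refine List.map_congr_left fun i hi => ?_
      have hi' : i < (t m').level :=
        (List.mem_range.1 hi).trans_le (hm.trans (hbranch m m' hm').1)
      rw [hβ i hi', hα m' i hi']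
    rw [he]
    exact hβP n
  obtain ⟨x, rfl⟩ := hyX
  have hx : Filter.Tendsto b Filter.atTop (𝓝 x) :=
    (UniformSpace.Completion.isUniformInducing_coe X).isInducing.tendsto_nhds_iff.2 hy
  refine ⟨x, mem_iInter.2 fun m => mem_closure_of_tendsto hx ?_⟩
  filter_upwards [Filter.eventually_ge_atTop m] with m' hm'
  exact hanti hm' (hb m')

/-- Each `bitSeq k` is a jump of `g`: near `bitSeq k` the values of `g` at the other points keep
away from the value at `bitSeq k`. -/
def HasJumpsAtBitSeq (g : (ℕ → Bool) → Y) : Prop :=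
  ∀ k, ∃ δ > 0, ∃ m, ∀ z, truncNat z m = truncNat (bitSeq k) m → z ≠ bitSeq k →
    δ ≤ dist (g z) (g (bitSeq k))

theorem exists_embedding_hasJumpsAtBitSeq (hX : IsAbsoluteSouslinF X) {f : X → Y}
    (hf : Sigma02Measurable f) (hpc : ¬ PiecewiseContinuous f) :
    ∃ φ : (ℕ → Bool) → X, IsEmbedding φ ∧ HasJumpsAtBitSeq (f ∘ φ) := by
  obtain ⟨P, hP, hXP⟩ := hX
  have hbase : ∃ t : LargeNode X, t.Good P f := by
    rw [piecewiseContinuous_iff_smallFor_univ] at hpc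
    obtain ⟨t, ht, -⟩ := LargeNode.exists_good (P := P) hpc (α := fun _ => 0) (l := 0) (by
      intro x _
      have : (x : UniformSpace.Completion X) ∈ souslinOperation P := hXP ▸ mem_range_self x
      obtain ⟨β, hβ⟩ := mem_iUnion.1 this
      exact ⟨β, fun i hi => absurd hi (Nat.not_lt_zero i), mem_iInter.1 hβ⟩)
    exact ⟨t, ht⟩
  obtain ⟨h, hgood, hchild⟩ := exists_binary_tree (fun t : LargeNode X => t.Good P f)
    (LargeNode.Child f)
    (fun p j t => p.point ∉ closure j.carrier → Disjoint (closure j.carrier) (closure t.carrier))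
    hbase (fun m p hp s hs _ => LargeNode.exists_child hf m hp hs)
  have hc := fun k m hk => (hchild k m hk).1
  have hnot : ∀ k m, k < 2 ^ m → (h k).point ∉ closure (h (k + 2 ^ m)).carrier := by
    intro k m hk hmem
    have h1 := (hc k m hk).lt_dist _ hmem
    rw [dist_self] at h1
    exact h1.not_ge (hgood k).jump_pos.le
  obtain ⟨φ, hφ, hφq, hφF⟩ := exists_embedding_of_scheme (x := fun k => (h k).point)
    (F := fun k => closure (h k).carrier) (fun k => (hgood k).mem_closure)
    (fun k m hk => closure_mono (hc k m hk).subset) (fun k m hk => (hc k m hk).closure_subset)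
    hnot (fun k m m' hk hm => by
      have h2 : 2 ^ m < 2 ^ m' := Nat.pow_lt_pow_right (by norm_num) hm
      exact (hchild k m' (hk.trans h2)).2 _ (by omega) (hnot k m hk))
    -- A digit `0` repeats the node and a digit `1` raises the Souslin level; infinitely many `1`s
    -- make the levels unbounded and the diameters tend to zero.
    (fun z hz => by
      have hstep : ∀ m, (h (truncNat z (m + 1))).carrier ⊆ (h (truncNat z m)).carrier ∧
          (h (truncNat z m)).level ≤ (h (truncNat z (m + 1))).level ∧
          ∀ i < (h (truncNat z m)).level,
            (h (truncNat z (m + 1))).branch i = (h (truncNat z m)).branch i := by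
        intro m
        cases hzm : z m with
        | false => rw [truncNat_succ_of_false hzm]; exact ⟨Subset.rfl, le_rfl, fun _ _ => rfl⟩
        | true =>
          rw [truncNat_succ_of_true hzm]
          have := hc _ m (truncNat_lt z m)
          exact ⟨this.subset, by rw [this.level_eq]; omega, this.branch_eq⟩
      have hmono : Monotone fun m => (h (truncNat z m)).level :=
        monotone_nat_of_le_succ fun m => (hstep m).2.1
      refine exists_mem_iInter_closure_of_souslin hP hXP (t := fun m => h (truncNat z m))
        (fun m => (hgood _).subset_piece) (fun m => (hgood _).nonempty)
        (antitone_nat_of_succ_le fun m => (hstep m).1) ?_ ?_ ?_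
      · intro N
        induction N with
        | zero => exact ⟨0, Nat.zero_le _⟩
        | succ N ih =>
          obtain ⟨m, hm⟩ := ih
          obtain ⟨m', hm', hzm⟩ := exists_true_of_notMem hz m
          refine ⟨m' + 1, ?_⟩
          have h1 := (hc _ m' (truncNat_lt z m')).level_eq
          have h2 : (h (truncNat z m)).level ≤ (h (truncNat z m')).level := hmono hm'
          rw [truncNat_succ_of_true hzm, h1]
          omega
      · intro m m' hm
        induction m', hm using Nat.le_induction with
        | base => exact ⟨le_rfl, fun _ _ => rfl⟩
        | succ n hn ih =>
          refine ⟨ih.1.trans (hstep n).2.1, fun i hi => ?_⟩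
          rw [(hstep n).2.2 i (hi.trans_le ih.1), ih.2 i hi]
      · intro ε hε
        obtain ⟨m, hm⟩ := exists_pow_lt_of_lt_one hε (show (1 / 2 : ℝ) < 1 by norm_num)
        obtain ⟨m', hm', hzm⟩ := exists_true_of_notMem hz m
        refine ⟨m' + 1, (h (truncNat z m')).point, ?_⟩
        rw [truncNat_succ_of_true hzm]
        refine subset_closure.trans ((hc _ m' (truncNat_lt z m')).closure_subset.trans
          (Metric.closedBall_subset_closedBall ?_))
        exact (pow_le_pow_of_le_one (by norm_num) (by norm_num) hm').trans hm.le)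
  -- Since `k < 2 ^ k`, the first `k` digits determine `k`; any other sequence sharing them passes
  -- through a child of node `k`.
  refine ⟨φ, hφ, fun k => ⟨(h k).jump, (hgood k).jump_pos, k, fun z hz hzk => ?_⟩⟩
  rw [truncNat_bitSeq Nat.lt_two_pow_self] at hz
  rcases eq_bitSeq_or_exists_next z k with h1 | ⟨m', hm', hzm, ht⟩
  · exact (hzk (by rw [h1, hz])).elim
  · have h2 := hφF z (m' + 1)
    rw [truncNat_succ_of_true hzm, ht, hz] at h2
    have hk : k < 2 ^ m' := hm'.trans_lt Nat.lt_two_pow_self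
    have := (hc k m' hk).lt_dist _ h2
    simp only [Function.comp_apply, hφq]
    exact this.le

end Souslin

/-! ### Separable range and continuity points of Σ⁰₂-measurable functions -/

section Baire

variable {Z Y : Type*} [TopologicalSpace Z] [MetricSpace Y]

theorem Sigma02Measurable.comp_continuous {W Z Y : Type*} [TopologicalSpace W]
    [TopologicalSpace Z] [TopologicalSpace Y] {f : Z → Y} (hf : Sigma02Measurable f) {φ : W → Z}
    (hφ : Continuous φ) : Sigma02Measurable (f ∘ φ) := by
  intro U hU
  obtain ⟨F, hF, he⟩ := hf U hU
  exact ⟨fun n => φ ⁻¹' F n, fun n => (hF n).preimage hφ, by rw [preimage_comp, he, preimage_iUnion]⟩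

/-- An uncountable set in a second countable space contains two disjoint countable sets with the
same nonempty closure. -/
theorem exists_disjoint_countable_closure_eq [SecondCountableTopology Z] {T : Set Z}
    (hT : ¬ T.Countable) : ∃ D₀ ⊆ T, ∃ D₁ ⊆ T, D₀.Nonempty ∧ Disjoint D₀ D₁ ∧
      closure D₀ = closure D₁ := by
  -- As in the Cantor–Bendixson theorem, discarding countably many points leaves a set all of whose
  -- points are condensation points of it; removing the countable `D₀` does not change its closure.
  let N : Set Z := ⋃ U ∈ {U ∈ TopologicalSpace.countableBasis Z | (U ∩ T).Countable}, U ∩ T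
  have hN : N.Countable := ((TopologicalSpace.countable_countableBasis Z).mono
    (sep_subset _ _)).biUnion fun U hU => hU.2
  have hunc : ∀ x ∈ T \ N, ∀ U : Set Z, IsOpen U → x ∈ U → ¬ (U ∩ (T \ N)).Countable := by
    intro x hx U hU hxU hc
    obtain ⟨V, hV, hxV, hVU⟩ :=
      (TopologicalSpace.isBasis_countableBasis Z).exists_subset_of_mem_open hxU hU
    refine hx.2 (mem_iUnion₂.2 ⟨V, ⟨hV, ?_⟩, hxV, hx.1⟩)
    refine (hc.union hN).mono fun y hy => ?_
    by_cases hyN : y ∈ N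
    · exact Or.inr hyN
    · exact Or.inl ⟨hVU hy.1, hy.2, hyN⟩
  have hsep : ∀ A : Set Z, ∃ D ⊆ A, D.Countable ∧ A ⊆ closure D := by
    intro A
    obtain ⟨D, hD, hcl⟩ := TopologicalSpace.exists_countable_dense A
    refine ⟨(↑) '' D, Subtype.coe_image_subset A D, hD.image _, fun x hx => ?_⟩
    exact image_closure_subset_closure_image continuous_subtype_val
      ⟨⟨x, hx⟩, hcl ⟨x, hx⟩, rfl⟩
  obtain ⟨D₀, hD₀, hc₀, hd₀⟩ := hsep (T \ N)
  obtain ⟨D₁, hD₁, -, hd₁⟩ := hsep ((T \ N) \ D₀)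
  have hne : (T \ N).Nonempty := by
    by_contra he
    rw [not_nonempty_iff_eq_empty, sdiff_eq_empty] at he
    exact hT (hN.mono he)
  refine ⟨D₀, hD₀.trans sdiff_subset, D₁, hD₁.trans (sdiff_subset.trans sdiff_subset), ?_,
    disjoint_right.2 fun x hx => (hD₁ hx).2, ?_⟩
  · rw [← closure_nonempty_iff]
    exact hne.mono hd₀
  · refine Subset.antisymm (closure_minimal (fun x hx => ?_) isClosed_closure)
      (closure_minimal (fun x hx => hd₀ (hD₁ hx).1) isClosed_closure)
    refine closure_minimal hd₁ isClosed_closure (mem_closure_iff.2 fun U hU hxU => ?_)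
    by_contra he
    refine hunc x (hD₀ hx) U hU hxU (hc₀.mono fun y hy => ?_)
    by_contra hy'
    exact he ⟨y, hy.1, hy.2, hy'⟩

/-- A set and a disjoint one cannot be separated by sets with `Σ⁰₂` complements if they are dense
in the same nonempty compact set. -/
theorem false_of_isSigma02_of_closure_eq [CompactSpace Z] [T2Space Z] {D₀ D₁ A₀ A₁ : Set Z}
    (hne : D₀.Nonempty) (hcl : closure D₀ = closure D₁) (h₀ : IsSigma02 A₀) (h₁ : IsSigma02 A₁)
    (hd₀ : Disjoint D₀ A₀) (hd₁ : Disjoint D₁ A₁) (hcov : A₀ ∪ A₁ = univ) : False := by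
  obtain ⟨F₀, hF₀, rfl⟩ := h₀
  obtain ⟨F₁, hF₁, rfl⟩ := h₁
  have hcomp : CompactSpace (closure D₀) := isCompact_iff_compactSpace.1 isClosed_closure.isCompact
  have : Nonempty (closure D₀) := (hne.mono subset_closure).to_subtype
  obtain ⟨i, ⟨x, hxc⟩, hx⟩ := nonempty_interior_of_iUnion_of_closed
    (f := fun i : ℕ ⊕ ℕ => ((↑) : closure D₀ → Z) ⁻¹' Sum.elim F₀ F₁ i)
    (by rintro (i | i)
        · exact (hF₀ i).preimage continuous_subtype_val
        · exact (hF₁ i).preimage continuous_subtype_val)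
    (by
      refine eq_univ_of_forall fun x => mem_iUnion.2 ?_
      have : (x : Z) ∈ (⋃ n, F₀ n) ∪ ⋃ n, F₁ n := hcov ▸ mem_univ _
      rcases this with h | h
      · obtain ⟨n, hn⟩ := mem_iUnion.1 h
        exact ⟨Sum.inl n, hn⟩
      · obtain ⟨n, hn⟩ := mem_iUnion.1 h
        exact ⟨Sum.inr n, hn⟩)
  rw [mem_interior_iff_mem_nhds, nhds_subtype_eq_comap, Filter.mem_comap] at hx
  obtain ⟨U, hU, hUF⟩ := hx
  rcases i with i | i
  · obtain ⟨d, hdU, hd⟩ := mem_closure_iff_nhds.1 hxc U hU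
    have : d ∈ F₀ i := hUF (a := ⟨d, subset_closure hd⟩) hdU
    exact disjoint_left.1 hd₀ hd (mem_iUnion.2 ⟨i, this⟩)
  · obtain ⟨d, hdU, hd⟩ := mem_closure_iff_nhds.1 (hcl ▸ hxc) U hU
    have : d ∈ F₁ i := hUF (a := ⟨d, hcl ▸ subset_closure hd⟩) hdU
    exact disjoint_left.1 hd₁ hd (mem_iUnion.2 ⟨i, this⟩)

theorem isClosed_of_forall_le_dist {S : Set Y} {ε : ℝ} (hε : 0 < ε)
    (hS : ∀ x ∈ S, ∀ y ∈ S, x ≠ y → ε ≤ dist x y) : IsClosed S := by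
  have hlf : LocallyFinite fun i : S => ({(i : Y)} : Set Y) :=
    locallyFinite_of_separated hε fun i j hij x hx y hy => by
      rw [mem_singleton_iff.1 hx, mem_singleton_iff.1 hy]
      exact hS i i.2 j j.2 fun h => hij (Subtype.ext h)
  simpa using hlf.isClosed_iUnion fun i => isClosed_singleton

/-- All subsets of a separated set are closed. Were `S` uncountable, a choice of one preimage per
value would contain two disjoint sets with the same closure; the preimages of their images are
disjoint, have Σ⁰₂ complements and contradict Baire's theorem. -/
theorem Sigma02Measurable.countable_of_separated [CompactSpace Z] [T2Space Z]
    [SecondCountableTopology Z] {g : Z → Y} (hg : Sigma02Measurable g) {S : Set Y} {ε : ℝ}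
    (hε : 0 < ε) (hSr : S ⊆ range g) (hS : ∀ x ∈ S, ∀ y ∈ S, x ≠ y → ε ≤ dist x y) :
    S.Countable := by
  by_contra hunc
  have : Nonempty Z := by
    obtain ⟨y, hy⟩ : S.Nonempty := by
      by_contra he
      exact hunc (not_nonempty_iff_eq_empty.1 he ▸ countable_empty)
    exact ⟨(hSr hy).choose⟩
  have hSr' : ∀ y ∈ S, ∃ z, g z = y := fun y hy => hSr hy
  choose! x hx using hSr'
  have hT : ¬ (x '' S).Countable := by
    intro hc
    have hsub : S ⊆ g '' (x '' S) := fun y hy => ⟨x y, mem_image_of_mem x hy, hx y hy⟩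
    exact hunc ((hc.image g).mono hsub)
  obtain ⟨D₀, hD₀, D₁, hD₁, hne, hdisj, hcl⟩ := exists_disjoint_countable_closure_eq hT
  have hgx : ∀ z ∈ x '' S, g z ∈ S ∧ x (g z) = z := by
    rintro _ ⟨y, hy, rfl⟩
    rw [hx y hy]
    exact ⟨hy, rfl⟩
  have hclosed : ∀ D ⊆ x '' S, IsClosed (g '' D) := by
    intro D hD
    refine isClosed_of_forall_le_dist hε ?_
    rintro _ ⟨a, ha, rfl⟩ _ ⟨b, hb, rfl⟩ hab
    exact hS _ (hgx a (hD ha)).1 _ (hgx b (hD hb)).1 hab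
  refine false_of_isSigma02_of_closure_eq hne hcl (hg _ (hclosed D₀ hD₀).isOpen_compl)
    (hg _ (hclosed D₁ hD₁).isOpen_compl) (disjoint_left.2 fun z hz h => h ⟨z, hz, rfl⟩)
    (disjoint_left.2 fun z hz h => h ⟨z, hz, rfl⟩) (eq_univ_of_forall fun z => ?_)
  by_contra hz
  simp only [mem_union, mem_preimage, mem_compl_iff, not_or, not_not] at hz
  obtain ⟨⟨a, ha, hag⟩, b, hb, hbg⟩ := hz
  have : a = b := by rw [← (hgx a (hD₀ ha)).2, ← (hgx b (hD₁ hb)).2, hag, hbg]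
  exact disjoint_left.1 hdisj ha (this ▸ hb)

theorem exists_maximal_separated (A : Set Y) {ε : ℝ} (hε : 0 < ε) :
    ∃ N, (N ⊆ A ∧ ∀ x ∈ N, ∀ y ∈ N, x ≠ y → ε ≤ dist x y) ∧ ∀ y ∈ A, ∃ b ∈ N, dist y b < ε := by
  obtain ⟨N, hN⟩ : ∃ N, Maximal
      (· ∈ {N : Set Y | N ⊆ A ∧ ∀ x ∈ N, ∀ y ∈ N, x ≠ y → ε ≤ dist x y}) N := by
    refine zorn_subset _ fun c hc hchain => ⟨⋃₀ c, ⟨sUnion_subset fun s hs => (hc hs).1, ?_⟩,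
      fun s hs => subset_sUnion_of_mem hs⟩
    rintro x ⟨s, hs, hx⟩ y ⟨t, ht, hy⟩ hxy
    rcases hchain.total hs ht with h | h
    · exact (hc ht).2 x (h hx) y hy hxy
    · exact (hc hs).2 x hx y (h hy) hxy
  refine ⟨N, hN.prop, fun y hy => ?_⟩
  by_contra! hc
  have hyN : y ∈ N := by
    refine hN.le_of_ge (y := insert y N) ⟨insert_subset hy hN.prop.1, ?_⟩ (subset_insert y N)
      (mem_insert y N)
    rintro a (rfl | ha) b (rfl | hb) hab
    · exact (hab rfl).elim
    · exact hc b hb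
    · rw [dist_comm]; exact hc a ha
    · exact hN.prop.2 a ha b hb hab
  have := hc y hyN
  rw [dist_self] at this
  linarith

theorem Sigma02Measurable.isSeparable_range [CompactSpace Z] [T2Space Z]
    [SecondCountableTopology Z] {g : Z → Y} (hg : Sigma02Measurable g) :
    TopologicalSpace.IsSeparable (range g) := by
  choose N hN hcov using fun n : ℕ =>
    exists_maximal_separated (range g) (show (0 : ℝ) < (1 / 2) ^ n by positivity)
  refine ⟨⋃ n, N n, countable_iUnion fun n =>
    hg.countable_of_separated (ε := (1 / 2) ^ n) (by positivity) (hN n).1 (hN n).2,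
    fun y hy => Metric.mem_closure_iff.2 fun ε hε => ?_⟩
  obtain ⟨n, hn⟩ := exists_pow_lt_of_lt_one hε (show (1 / 2 : ℝ) < 1 by norm_num)
  obtain ⟨b, hb, hyb⟩ := hcov n y hy
  exact ⟨b, mem_iUnion.2 ⟨n, hb⟩, hyb.trans hn⟩

/-- A `Σ⁰₂`-measurable function on a compact metrizable space has a dense set of continuity
points. -/
theorem Sigma02Measurable.dense_continuousAt [CompactSpace Z] [T2Space Z]
    [SecondCountableTopology Z] {g : Z → Y} (hg : Sigma02Measurable g) :
    Dense {z | ContinuousAt g z} := by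
  obtain ⟨t, ht, htr⟩ := hg.isSeparable_range
  have : Countable t := ht.to_subtype
  choose F hF hgF using fun p : t × ℕ => hg (Metric.ball p.1 ((1 / 2) ^ p.2)) Metric.isOpen_ball
  -- Countably many balls detect all values. A point off the frontiers of the closed pieces of their
  -- preimages is interior to each piece containing it.
  have hd : Dense (⋂ p : (t × ℕ) × ℕ, (frontier (F p.1 p.2))ᶜ) :=
    dense_iInter_of_isOpen (fun p => isClosed_frontier.isOpen_compl)
      fun p => interior_eq_empty_iff_dense_compl.1 (interior_frontier (hF _ _))
  refine hd.mono fun z hz => Metric.continuousAt_iff'.2 fun ε hε => ?_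
  obtain ⟨n, hn⟩ := exists_pow_lt_of_lt_one (show 0 < ε / 2 by positivity)
    (show (1 / 2 : ℝ) < 1 by norm_num)
  obtain ⟨y, hy, hyd⟩ := Metric.mem_closure_iff.1 (htr (mem_range_self z)) ((1 / 2) ^ n)
    (by positivity)
  have hz1 : z ∈ g ⁻¹' Metric.ball y ((1 / 2) ^ n) := hyd
  rw [hgF (⟨y, hy⟩, n)] at hz1
  obtain ⟨k, hk⟩ := mem_iUnion.1 hz1
  have hzi : z ∈ interior (F (⟨y, hy⟩, n) k) := by
    by_contra h
    exact mem_iInter.1 hz ((⟨y, hy⟩, n), k) ⟨subset_closure hk, h⟩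
  filter_upwards [isOpen_interior.mem_nhds hzi] with w hw
  have hw1 : w ∈ g ⁻¹' Metric.ball y ((1 / 2) ^ n) := by
    rw [hgF (⟨y, hy⟩, n)]
    exact mem_iUnion.2 ⟨k, interior_subset hw⟩
  have hw2 : dist (g w) y < (1 / 2) ^ n := hw1
  have := dist_triangle_right (g w) (g z) y
  linarith

end Baire

/-! ### The two constructions in a compact space -/

section Compact

variable {Z Y : Type*} [MetricSpace Z] [CompactSpace Z] [MetricSpace Y] {g : Z → Y}

theorem exists_embedding_of_compact_scheme {x : ℕ → Z} {F : ℕ → Set Z} (hx : ∀ k, x k ∈ F k)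
    (hF : ∀ k, IsClosed (F k)) (hsub : ∀ k m, k < 2 ^ m → F (k + 2 ^ m) ⊆ F k)
    (hball : ∀ k m, k < 2 ^ m → F (k + 2 ^ m) ⊆ Metric.closedBall (x k) ((1 / 2) ^ m))
    (hnot : ∀ k m, k < 2 ^ m → x k ∉ F (k + 2 ^ m))
    (hdisj : ∀ k m m', k < 2 ^ m → m < m' → Disjoint (F (k + 2 ^ m)) (F (k + 2 ^ m'))) :
    ∃ φ : (ℕ → Bool) → Z, IsEmbedding φ ∧ (∀ k, φ (bitSeq k) = x k) ∧
      ∀ z m, φ z ∈ F (truncNat z m) := by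
  refine exists_embedding_of_scheme hx hsub hball hnot hdisj fun z _ => ?_
  refine IsCompact.nonempty_iInter_of_sequence_nonempty_isCompact_isClosed _ (fun m => ?_)
    (fun m => ⟨_, hx _⟩) (hF _).isCompact fun m => hF _
  cases hz : z m with
  | false => rw [truncNat_succ_of_false hz]
  | true => rw [truncNat_succ_of_true hz]; exact hsub _ _ (truncNat_lt _ _)

/-- Near `x` the values of `g` at the other points keep away from `g x`. -/
def HasJumpAt (g : Z → Y) (x : Z) : Prop :=
  ∃ δ > 0, ∀ᶠ z in 𝓝[≠] x, δ ≤ dist (g z) (g x)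

omit [CompactSpace Z] in
theorem nonempty_sdiff_singleton_of_isOpen [hp : ∀ x : Z, (𝓝[≠] x).NeBot] {O : Set Z}
    (hO : IsOpen O) {x : Z} (hx : x ∈ O) : (O \ {x}).Nonempty := by
  obtain ⟨z, hz⟩ := (hp x).nonempty_of_mem
    (Filter.inter_mem (mem_nhdsWithin_of_mem_nhds (hO.mem_nhds hx)) self_mem_nhdsWithin)
  exact ⟨z, hz.1, hz.2⟩

omit [CompactSpace Z] in
theorem exists_isOpen_subset_dist_lt (hC : Dense {z | ContinuousAt g z}) {O : Set Z}
    (hO : IsOpen O) (hne : O.Nonempty) {ε : ℝ} (hε : 0 < ε) :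
    ∃ O' ⊆ O, IsOpen O' ∧ ∃ c ∈ O', ContinuousAt g c ∧ ∀ z ∈ O', dist (g z) (g c) < ε := by
  obtain ⟨c, hcO, hc⟩ := hC.inter_open_nonempty O hO hne
  have hc' : ContinuousAt g c := hc
  obtain ⟨W, hW, hWo, hcW⟩ := mem_nhds_iff.1 (Metric.continuousAt_iff'.1 hc' ε hε)
  exact ⟨O ∩ W, inter_subset_left, hO.inter hWo, c, ⟨hcO, hcW⟩, hc, fun z hz => hW hz.2⟩

omit [CompactSpace Z] in
theorem exists_isOpen_closure_subset {O : Set Z} (hO : IsOpen O) {c : Z} (hc : c ∈ O) :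
    ∃ O', IsOpen O' ∧ c ∈ O' ∧ closure O' ⊆ O := by
  obtain ⟨r, hr, h⟩ := Metric.nhds_basis_closedBall.mem_iff.1 (hO.mem_nhds hc)
  exact ⟨Metric.ball c r, Metric.isOpen_ball, Metric.mem_ball_self hr,
    Metric.closure_ball_subset_closedBall.trans h⟩

theorem exists_pos_le_of_finite {T : Type*} {s : Set T} (hs : s.Finite) {a : T → ℝ}
    (ha : ∀ j ∈ s, 0 < a j) : ∃ ε > 0, ∀ j ∈ s, ε ≤ a j := by
  induction s, hs using Set.Finite.induction_on with
  | empty => exact ⟨1, one_pos, fun j hj => hj.elim⟩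
  | insert _ _ ih =>
    obtain ⟨ε, hε, h⟩ := ih fun j hj => ha j (mem_insert_of_mem _ hj)
    refine ⟨min ε (a _), lt_min hε (ha _ (mem_insert _ _)), ?_⟩
    rintro j (rfl | hj)
    · exact min_le_right _ _
    · exact (min_le_left _ _).trans (h j hj)

/-- Inside the neighbourhoods shrinking to a node's point, continuity points and concentration give
open sets with values as close to `y` as desired. Branches with infinitely many `1`s then get the
value `y`, while the node points are chosen with values different from `y`. -/
theorem exists_embedding_of_concentrated [hp : ∀ x : Z, (𝓝[≠] x).NeBot]
    (hC : Dense {z | ContinuousAt g z}) (hJ : Dense {x | HasJumpAt g x}) {O : Set Z}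
    (hO : IsOpen O) (hne : O.Nonempty) {y : Y}
    (hy : ∀ O' ⊆ O, IsOpen O' → O'.Nonempty → ∀ ε > 0, ∃ z ∈ O', dist (g z) y < ε) :
    ∃ φ : (ℕ → Bool) → Z, IsEmbedding φ ∧ (∀ z ∉ eventuallyZero, g (φ z) = y) ∧
      (∀ k, g (φ (bitSeq k)) ≠ y) ∧ Function.Injective (fun k => g (φ (bitSeq k))) ∧
      Filter.Tendsto (fun k => g (φ (bitSeq k))) Filter.atTop (𝓝 y) := by
  -- A jump point with value `y` would keep the nearby values away from `y`, against concentration.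
  have hjump : ∀ O' ⊆ O, IsOpen O' → O'.Nonempty → ∃ x ∈ O', g x ≠ y := by
    intro O' hOO hO' hne'
    obtain ⟨x, hxO, δ, hδ, hx⟩ := hJ.inter_open_nonempty O' hO' hne'
    refine ⟨x, hxO, ?_⟩
    rintro rfl
    obtain ⟨W, hW, hxW, hWδ⟩ := mem_nhdsWithin.1 hx
    obtain ⟨z, hz, hzδ⟩ := hy ((O' ∩ W) \ {x}) (sdiff_subset.trans (inter_subset_left.trans hOO))
      ((hO'.inter hW).sdiff isClosed_singleton)
      (nonempty_sdiff_singleton_of_isOpen (hO'.inter hW) ⟨hxO, hxW⟩) δ hδ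
    exact (hWδ ⟨hz.1.2, hz.2⟩).not_gt hzδ
  obtain ⟨h, hgood, hchild⟩ := exists_binary_tree
    (fun t : Set Z × Z => IsOpen t.1 ∧ t.1 ⊆ O ∧ t.2 ∈ t.1 ∧ g t.2 ≠ y)
    (fun m p t => closure t.1 ⊆ p.1 ∩ Metric.closedBall p.2 ((1 / 2) ^ m) ∧ p.2 ∉ closure t.1 ∧
      ∀ z ∈ closure t.1, dist (g z) y ≤ (1 / 2) ^ m)
    -- Each new value is closer to `y` than all earlier ones; the strict decrease gives injectivity
    -- and lets convergence be read off at the children `2 ^ m` of node `0`.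
    (fun p j t => (p.2 ∉ closure j.1 → Disjoint (closure j.1) (closure t.1)) ∧
      dist (g t.2) y < dist (g j.2) y)
    (by
      obtain ⟨x, hx, hxy⟩ := hjump O Subset.rfl hO hne
      exact ⟨(O, x), hO, Subset.rfl, hx, hxy⟩)
    (by
      rintro m p ⟨hpo, hpO, hpx, -⟩ s hs hsg
      obtain ⟨ε, hε, hεs⟩ := exists_pos_le_of_finite hs (a := fun j => dist (g j.2) y)
        fun j hj => dist_pos.2 (hsg j hj).2.2.2
      have hmin : 0 < min ε ((1 / 2 : ℝ) ^ m) := lt_min hε (by positivity)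
      let V : Set Z := (p.1 ∩ Metric.ball p.2 ((1 / 2) ^ m)) ∩
        ⋂ j ∈ {j ∈ s | p.2 ∉ closure j.1}, (closure j.1)ᶜ
      have hV : IsOpen V := (hpo.inter Metric.isOpen_ball).inter
        ((hs.subset (sep_subset _ _)).isOpen_biInter fun j _ => isClosed_closure.isOpen_compl)
      have hpV : p.2 ∈ V := ⟨⟨hpx, Metric.mem_ball_self (by positivity)⟩,
        mem_iInter₂.2 fun j hj => hj.2⟩
      obtain ⟨O₁, hO₁V, hO₁, c, hc, -, hcd⟩ := exists_isOpen_subset_dist_lt hC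
        (hV.sdiff (isClosed_singleton (x := p.2))) (nonempty_sdiff_singleton_of_isOpen hV hpV)
        (show 0 < min ε ((1 / 2 : ℝ) ^ m) / 3 by positivity)
      have hO₁O : O₁ ⊆ O := fun z hz => hpO (hO₁V hz).1.1.1
      obtain ⟨w, hw, hwy⟩ := hy O₁ hO₁O hO₁ ⟨c, hc⟩ (min ε ((1 / 2 : ℝ) ^ m) / 3) (by positivity)
      have hO₁y : ∀ z ∈ O₁, dist (g z) y < min ε ((1 / 2 : ℝ) ^ m) := by
        intro z hz
        have h1 := hcd z hz
        have h2 := hcd w hw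
        have h3 := dist_triangle_right (g z) (g w) (g c)
        have h4 := dist_triangle (g z) (g w) y
        linarith
      obtain ⟨O₂, hO₂, hcO₂, hcl⟩ := exists_isOpen_closure_subset hO₁ hc
      have hO₂₁ : O₂ ⊆ O₁ := subset_closure.trans hcl
      obtain ⟨x, hx, hxy⟩ := hjump O₂ (hO₂₁.trans hO₁O) hO₂ ⟨c, hcO₂⟩
      refine ⟨(O₂, x), ⟨hO₂, hO₂₁.trans hO₁O, hx, hxy⟩, ⟨fun z hz => ?_, fun hpc => ?_,
        fun z hz => ?_⟩, fun j hj => ⟨fun hpj => disjoint_right.2 fun z hz => ?_, ?_⟩⟩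
      · have := (hO₁V (hcl hz)).1.1
        exact ⟨this.1, Metric.ball_subset_closedBall this.2⟩
      · exact (hO₁V (hcl hpc)).2 rfl
      · exact ((hO₁y z (hcl hz)).trans_le (min_le_right _ _)).le
      · exact mem_iInter₂.1 (hO₁V (hcl hz)).1.2 j ⟨hj, hpj⟩
      · exact ((hO₁y x (hO₂₁ hx)).trans_le (min_le_left _ _)).trans_le (hεs j hj))
  have hc := fun k m hk => (hchild k m hk).1
  obtain ⟨φ, hφ, hφq, hφF⟩ := exists_embedding_of_compact_scheme (x := fun k => (h k).2)
    (F := fun k => closure (h k).1) (fun k => subset_closure (hgood k).2.2.1)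
    (fun k => isClosed_closure)
    (fun k m hk => ((hc k m hk).1.trans inter_subset_left).trans subset_closure)
    (fun k m hk => (hc k m hk).1.trans inter_subset_right) (fun k m hk => (hc k m hk).2.1)
    (fun k m m' hk hm => by
      have h2 : 2 ^ m < 2 ^ m' := Nat.pow_lt_pow_right (by norm_num) hm
      exact ((hchild k m' (hk.trans h2)).2 _ (by omega)).1 (hc k m hk).2.1)
  have hanti : StrictAnti fun k => dist (g (h k).2) y := by
    intro j n hjn
    have hn : n ≠ 0 := by omega
    have h1 : 2 ^ Nat.log 2 n ≤ n := Nat.pow_log_le_self 2 hn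
    have h2 : n < 2 ^ (Nat.log 2 n + 1) := Nat.lt_pow_succ_log_self (by norm_num) n
    rw [pow_succ] at h2
    have h3 := ((hchild (n - 2 ^ Nat.log 2 n) (Nat.log 2 n) (by omega)).2 j (by omega)).2
    rwa [Nat.sub_add_cancel h1] at h3
  refine ⟨φ, hφ, fun z hz => ?_, fun k => ?_, fun j k hjk => ?_, ?_⟩
  · refine eq_of_forall_dist_le fun ε hε => ?_
    obtain ⟨m, hm⟩ := exists_pow_lt_of_lt_one hε (show (1 / 2 : ℝ) < 1 by norm_num)
    obtain ⟨m', hm', hzm⟩ := exists_true_of_notMem hz m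
    have h1 := hφF z (m' + 1)
    rw [truncNat_succ_of_true hzm] at h1
    exact ((hc _ m' (truncNat_lt z m')).2.2 _ h1).trans
      ((pow_le_pow_of_le_one (by norm_num) (by norm_num) hm').trans hm.le)
  · rw [hφq]; exact (hgood k).2.2.2
  · simp only [hφq] at hjk
    exact hanti.injective (congrArg (fun w => dist w y) hjk)
  · simp only [hφq]
    refine Metric.tendsto_atTop.2 fun ε hε => ?_
    obtain ⟨m, hm⟩ := exists_pow_lt_of_lt_one hε (show (1 / 2 : ℝ) < 1 by norm_num)
    refine ⟨0 + 2 ^ m, fun n hn => (hanti.antitone hn).trans_lt (lt_of_le_of_lt ?_ hm)⟩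
    exact (hc 0 m (by positivity)).2.2 _ (subset_closure (hgood _).2.2.1)

omit [CompactSpace Z] in
theorem exists_isOpen_subset_separated (hC : Dense {z | ContinuousAt g z})
    (hII : ∀ O : Set Z, IsOpen O → O.Nonempty → ∀ y, ∃ O' ⊆ O, IsOpen O' ∧ O'.Nonempty ∧
      ∃ ε > 0, ∀ z ∈ O', ε ≤ dist (g z) y) {O : Set Z} (hO : IsOpen O) (hne : O.Nonempty) :
    ∃ O₁ ⊆ O, ∃ O₂ ⊆ O, IsOpen O₁ ∧ O₁.Nonempty ∧ IsOpen O₂ ∧ O₂.Nonempty ∧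
      ∃ ε > 0, ∀ u ∈ O₁, ∀ v ∈ O₂, ε ≤ dist (g u) (g v) := by
  obtain ⟨c, hcO, hc⟩ := hC.inter_open_nonempty O hO hne
  have hc' : ContinuousAt g c := hc
  obtain ⟨O₁, h1, ho1, hn1, ε, hε, hd⟩ := hII O hO hne (g c)
  obtain ⟨W, hW, hWo, hcW⟩ := mem_nhds_iff.1 (Metric.continuousAt_iff'.1 hc' (ε / 2) (by positivity))
  refine ⟨O₁, h1, O ∩ W, inter_subset_left, ho1, hn1, hO.inter hWo, ⟨c, hcO, hcW⟩, ε / 2,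
    by positivity, fun u hu v hv => ?_⟩
  have h2 := hd u hu
  have h3 : dist (g v) (g c) < ε / 2 := hW hv.2
  have := dist_triangle (g u) (g v) (g c)
  linarith

omit [CompactSpace Z] in
/-- From a decreasing sequence of sets with nonempty interiors one can split off an open subset
of one of them whose values keep away from those on the remaining parts. -/
theorem exists_split_off (hC : Dense {z | ContinuousAt g z})
    (hII : ∀ O : Set Z, IsOpen O → O.Nonempty → ∀ y, ∃ O' ⊆ O, IsOpen O' ∧ O'.Nonempty ∧
      ∃ ε > 0, ∀ z ∈ O', ε ≤ dist (g z) y) {E : ℕ → Set Z} (hE : Antitone E)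
    (hne : ∀ m, (interior (E m)).Nonempty) (i : ℕ) :
    ∃ C ⊆ E i, IsOpen C ∧ C.Nonempty ∧ ∃ E' : ℕ → Set Z, Antitone E' ∧ (∀ m, E' m ⊆ E m) ∧
      (∀ m, (interior (E' m)).Nonempty) ∧
      ∃ ε > 0, ∀ u ∈ C, ∀ m, ∀ v ∈ E' m, ε ≤ dist (g u) (g v) := by
  obtain ⟨O₁, hs1, O₂, hs2, ho1, hn1, ho2, hn2, ε, hε, hd⟩ :=
    exists_isOpen_subset_separated hC hII (isOpen_interior (s := E i)) (hne i)
  -- By the triangle inequality, an open set on which values lie within `ε / 6` of `g c` cannot have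
  -- points with values `ε / 3`-close to both `O₁` and `O₂`. It therefore lies in one of the two
  -- remainders.
  let R : Set Z → ℕ → Set Z := fun C m => {z ∈ E m | ∀ u ∈ C, ε / 3 ≤ dist (g u) (g z)}
  have hR : ∀ C, Antitone (R C) := fun C m m' hm z hz => ⟨hE hm hz.1, hz.2⟩
  have key : ∀ m, (interior (R O₁ m)).Nonempty ∨ (interior (R O₂ m)).Nonempty := by
    intro m
    obtain ⟨V, hV, hVo, c, hc, -, hcd⟩ :=
      exists_isOpen_subset_dist_lt hC isOpen_interior (hne m) (show 0 < ε / 6 by positivity)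
    by_contra! hcon
    have h1 : ¬ V ⊆ R O₁ m := fun h => (hcon.1 ▸ interior_maximal h hVo hc : c ∈ (∅ : Set Z))
    have h2 : ¬ V ⊆ R O₂ m := fun h => (hcon.2 ▸ interior_maximal h hVo hc : c ∈ (∅ : Set Z))
    obtain ⟨v, hv, hvR⟩ := not_subset.1 h1
    obtain ⟨w, hw, hwR⟩ := not_subset.1 h2
    have h3 : ∃ a ∈ O₁, dist (g a) (g v) < ε / 3 := by
      by_contra! hh
      exact hvR ⟨interior_subset (hV hv), hh⟩
    have h4 : ∃ b ∈ O₂, dist (g b) (g w) < ε / 3 := by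
      by_contra! hh
      exact hwR ⟨interior_subset (hV hw), hh⟩
    obtain ⟨a, ha, hav⟩ := h3
    obtain ⟨b, hb, hbw⟩ := h4
    have h5 := hd a ha b hb
    have h6 := dist_triangle4 (g a) (g v) (g w) (g b)
    have h7 := dist_triangle_right (g v) (g w) (g c)
    have h8 := hcd v hv
    have h9 := hcd w hw
    rw [dist_comm (g w) (g b)] at h6
    linarith
  -- The remainders decrease with `m`, so if `O₁` fails once it fails from then on, and `O₂` works
  -- for all `m`.
  have hcase : ∃ C ⊆ E i, IsOpen C ∧ C.Nonempty ∧ ∀ m, (interior (R C m)).Nonempty := by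
    by_cases h1 : ∀ m, (interior (R O₁ m)).Nonempty
    · exact ⟨O₁, hs1.trans interior_subset, ho1, hn1, h1⟩
    · push Not at h1
      obtain ⟨n, hn⟩ := h1
      refine ⟨O₂, hs2.trans interior_subset, ho2, hn2, fun m => ?_⟩
      have h2 := (key (max m n)).resolve_left fun h => by
        have h3 := h.mono (interior_mono (hR O₁ (le_max_right m n)))
        rw [hn] at h3
        exact not_nonempty_empty h3
      exact h2.mono (interior_mono (hR O₂ (le_max_left m n)))
  obtain ⟨C, hCE, hCo, hCn, hCR⟩ := hcase
  exact ⟨C, hCE, hCo, hCn, R C, hR C, fun m z hz => hz.1, hCR, ε / 3, by positivity,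
    fun u hu m v hv => hv.2 u hu⟩

-- Split off one set after another: `C j` with `j > i` lies in the remainder left by `C i`, whose
-- values keep a fixed distance from those on `C i`. Remainders need not be open, so only nonempty
-- interiors are carried along.
omit [CompactSpace Z] in
theorem exists_separated_sequence (hC : Dense {z | ContinuousAt g z})
    (hII : ∀ O : Set Z, IsOpen O → O.Nonempty → ∀ y, ∃ O' ⊆ O, IsOpen O' ∧ O'.Nonempty ∧
      ∃ ε > 0, ∀ z ∈ O', ε ≤ dist (g z) y) {D : ℕ → Set Z} (hD : Antitone D)
    (hDo : ∀ m, IsOpen (D m)) (hne : ∀ m, (D m).Nonempty) :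
    ∃ C : ℕ → Set Z, (∀ i, IsOpen (C i)) ∧ (∀ i, (C i).Nonempty) ∧ (∀ i, C i ⊆ D i) ∧
      ∀ n, ∃ ε > 0, ∀ i j, i ≤ n → i < j → ∀ u ∈ C i, ∀ v ∈ C j, ε ≤ dist (g u) (g v) := by
  let T := {E : ℕ → Set Z // Antitone E ∧ ∀ m, (interior (E m)).Nonempty}
  choose C hCE hCo hCn E' hE' hE's hE'n ε hε hd using
    fun (i : ℕ) (E : T) => exists_split_off hC hII E.2.1 E.2.2 i
  let E : ℕ → T := fun n => Nat.rec
    ⟨D, hD, fun m => by rw [(hDo m).interior_eq]; exact hne m⟩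
    (fun i E => ⟨E' i E, hE' i E, hE'n i E⟩) n
  have hEs : ∀ i, E (i + 1) = ⟨E' i (E i), hE' i (E i), hE'n i (E i)⟩ := fun i => rfl
  have hanti : ∀ i j m, i ≤ j → (E j).1 m ⊆ (E i).1 m := by
    intro i j m hij
    induction j, hij using Nat.le_induction with
    | base => rfl
    | succ j _ ih => exact (hE's j (E j) m).trans ih
  have hsep : ∀ i j, i < j → ∀ u ∈ C i (E i), ∀ v ∈ C j (E j), ε i (E i) ≤ dist (g u) (g v) := by
    intro i j hij u hu v hv
    exact hd i (E i) u hu j v (hanti (i + 1) j j hij (hCE j (E j) hv))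
  refine ⟨fun i => C i (E i), fun i => hCo _ _, fun i => hCn _ _,
    fun i => (hCE i (E i)).trans (hanti 0 i i (Nat.zero_le i)), fun n => ?_⟩
  obtain ⟨η, hη, h⟩ := exists_pos_le_of_finite (finite_Iic n) (a := fun i => ε i (E i))
    fun i _ => hε i (E i)
  exact ⟨η, hη, fun i j hi hij u hu v hv => (h i hi).trans (hsep i j hij u hu v hv)⟩

/-- A node of the tree used to find a copy of the Cantor space on which `g` separates points. -/
structure SplitNode (Z : Type*) where
  /-- the open set -/
  carrier : Set Z
  /-- the jump -/
  point : Z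
  /-- a sequence of sets converging to the jump, which will contain the children -/
  slot : ℕ → Set Z

/-- The requirements on a single node. -/
structure SplitNode.Good (g : Z → Y) (t : SplitNode Z) : Prop where
  mem : t.point ∈ t.carrier
  isOpen_slot : ∀ m, IsOpen (t.slot m)
  nonempty_slot : ∀ m, (t.slot m).Nonempty
  slot_subset : ∀ m, t.slot m ⊆ t.carrier ∩ Metric.closedBall t.point ((1 / 2) ^ m)
  jump : ∃ δ > 0, ∀ m, ∀ u ∈ t.slot m, δ ≤ dist (g u) (g t.point)
  separated : ∀ n, ∃ ε > 0, ∀ i j, i ≤ n → i < j → ∀ u ∈ t.slot i, ∀ v ∈ t.slot j,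
    ε ≤ dist (g u) (g v)

omit [CompactSpace Z] in
theorem SplitNode.exists_good [hp : ∀ x : Z, (𝓝[≠] x).NeBot]
    (hC : Dense {z | ContinuousAt g z}) (hJ : Dense {x | HasJumpAt g x})
    (hII : ∀ O : Set Z, IsOpen O → O.Nonempty → ∀ y, ∃ O' ⊆ O, IsOpen O' ∧ O'.Nonempty ∧
      ∃ ε > 0, ∀ z ∈ O', ε ≤ dist (g z) y) {O : Set Z} (hO : IsOpen O) (hne : O.Nonempty) :
    ∃ t : SplitNode Z, t.Good g ∧ t.carrier = O := by
  obtain ⟨x, hxO, δ, hδ, hx⟩ := hJ.inter_open_nonempty O hO hne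
  obtain ⟨W, hW, hxW, hWδ⟩ := mem_nhdsWithin.1 hx
  have hop : ∀ m, IsOpen ((O ∩ W) ∩ Metric.ball x ((1 / 2 : ℝ) ^ m)) :=
    fun m => (hO.inter hW).inter Metric.isOpen_ball
  obtain ⟨C, hCo, hCn, hCD, hsep⟩ := exists_separated_sequence hC hII
    (D := fun m => ((O ∩ W) ∩ Metric.ball x ((1 / 2 : ℝ) ^ m)) \ {x})
    (fun m m' hm => sdiff_subset_sdiff_left (inter_subset_inter_right _
      (Metric.ball_subset_ball (pow_le_pow_of_le_one (by norm_num) (by norm_num) hm))))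
    (fun m => (hop m).sdiff isClosed_singleton)
    (fun m => nonempty_sdiff_singleton_of_isOpen (hop m)
      ⟨⟨hxO, hxW⟩, Metric.mem_ball_self (by positivity)⟩)
  exact ⟨⟨O, x, C⟩, ⟨hxO, hCo, hCn, fun m z hz => ⟨(hCD m hz).1.1.1,
    Metric.ball_subset_closedBall (hCD m hz).1.2⟩, ⟨δ, hδ, fun m u hu =>
    hWδ ⟨(hCD m hu).1.1.2, (hCD m hu).2⟩⟩, hsep⟩, rfl⟩

/-- The child at `m` goes into slot `m` of its parent. Small oscillation on children gives
continuity along branches with infinitely many `1`s; the separation of slots from each other and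
from the jump point makes the values determine the digits. -/
theorem exists_embedding_of_separated [Nonempty Z] [hp : ∀ x : Z, (𝓝[≠] x).NeBot]
    (hC : Dense {z | ContinuousAt g z}) (hJ : Dense {x | HasJumpAt g x})
    (hII : ∀ O : Set Z, IsOpen O → O.Nonempty → ∀ y, ∃ O' ⊆ O, IsOpen O' ∧ O'.Nonempty ∧
      ∃ ε > 0, ∀ z ∈ O', ε ≤ dist (g z) y) :
    ∃ φ : (ℕ → Bool) → Z, IsEmbedding φ ∧ (∀ z ∉ eventuallyZero, ContinuousAt (g ∘ φ) z) ∧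
      (∀ k, ∃ ε > 0, ∀ z, z ≠ bitSeq k → ε ≤ dist (g (φ z)) (g (φ (bitSeq k)))) ∧
      ∀ z m, ∃ ε > 0, ∀ z', truncNat z' m ≠ truncNat z m → ε ≤ dist (g (φ z')) (g (φ z)) := by
  obtain ⟨h, hgood, hchild'⟩ := exists_binary_tree (fun t : SplitNode Z => t.Good g)
    (fun m p t => closure t.carrier ⊆ p.slot m ∧
      ∀ u ∈ closure t.carrier, ∀ v ∈ closure t.carrier, dist (g u) (g v) ≤ (1 / 2) ^ m)
    -- The slots of the parent already separate siblings, so the earlier nodes impose no condition.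
    (fun _ _ _ => True)
    (by
      obtain ⟨t, ht, -⟩ := SplitNode.exists_good hC hJ hII isOpen_univ univ_nonempty
      exact ⟨t, ht⟩)
    (by
      intro m p hpg s _ _
      obtain ⟨O₁, h1, ho1, c, hc, -, hcd⟩ := exists_isOpen_subset_dist_lt hC (hpg.isOpen_slot m)
        (hpg.nonempty_slot m) (show 0 < ((1 / 2 : ℝ) ^ m) / 2 by positivity)
      obtain ⟨O₂, ho2, hc2, hcl⟩ := exists_isOpen_closure_subset ho1 hc
      obtain ⟨t, ht, rfl⟩ := SplitNode.exists_good hC hJ hII ho2 ⟨c, hc2⟩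
      refine ⟨t, ht, ⟨hcl.trans h1, fun u hu v hv => ?_⟩, fun _ _ => trivial⟩
      have h3 := hcd u (hcl hu)
      have h4 := hcd v (hcl hv)
      have := dist_triangle_right (g u) (g v) (g c)
      linarith)
  have hchild := fun k m hk => (hchild' k m hk).1
  obtain ⟨φ, hφ, hφq, hφF⟩ := exists_embedding_of_compact_scheme (x := fun k => (h k).point)
    (F := fun k => closure (h k).carrier) (fun k => subset_closure (hgood k).mem)
    (fun k => isClosed_closure)
    (fun k m hk => ((hchild k m hk).1.trans
      (((hgood k).slot_subset m).trans inter_subset_left)).trans subset_closure)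
    (fun k m hk => (hchild k m hk).1.trans (((hgood k).slot_subset m).trans inter_subset_right))
    (fun k m hk hmem => by
      obtain ⟨δ, hδ, hd⟩ := (hgood k).jump
      have := hd m _ ((hchild k m hk).1 hmem)
      rw [dist_self] at this
      linarith)
    (fun k m m' hk hm => disjoint_left.2 fun z hz hz' => by
      obtain ⟨ε, hε, hd⟩ := (hgood k).separated m
      have h2 : 2 ^ m < 2 ^ m' := Nat.pow_lt_pow_right (by norm_num) hm
      have := hd m m' le_rfl hm z ((hchild k m hk).1 hz) z ((hchild k m' (hk.trans h2)).1 hz')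
      rw [dist_self] at this
      linarith)
  have hnext : ∀ z m, z = bitSeq (truncNat z m) ∨
      ∃ m', m ≤ m' ∧ z m' = true ∧ φ z ∈ (h (truncNat z m)).slot m' := by
    intro z m
    refine (eq_bitSeq_or_exists_next z m).imp_right ?_
    rintro ⟨m', hm', hz, ht⟩
    refine ⟨m', hm', hz, ?_⟩
    have h1 := hφF z (m' + 1)
    rw [truncNat_succ_of_true hz] at h1
    rw [← ht]
    exact (hchild _ m' (truncNat_lt z m')).1 h1
  have hsep : ∀ z m, ∃ ε > 0, ∀ z', truncNat z' m ≠ truncNat z m →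
      ε ≤ dist (g (φ z')) (g (φ z)) := by
    intro z m
    induction m with
    | zero => exact ⟨1, one_pos, fun z' h' => (h' rfl).elim⟩
    | succ m ih =>
      obtain ⟨ε₁, hε₁, h1⟩ := ih
      obtain ⟨ε₂, hε₂, h2⟩ := (hgood (truncNat z m)).separated m
      obtain ⟨δ, hδ, h3⟩ := (hgood (truncNat z m)).jump
      have key : ∀ u v, truncNat u m = truncNat z m → truncNat v m = truncNat z m →
          u m = true → v m = false → min ε₂ δ ≤ dist (g (φ u)) (g (φ v)) := by
        intro u v hu hv hum hvm
        have hus : φ u ∈ (h (truncNat z m)).slot m := by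
          have := hφF u (m + 1)
          rw [truncNat_succ_of_true hum] at this
          rw [← hu]
          exact (hchild _ m (truncNat_lt u m)).1 this
        rcases hnext v m with hq | ⟨m', hm', hvm', hvs⟩
        · rw [hq, hφq, hv]
          exact (min_le_right _ _).trans (h3 m _ hus)
        · rw [hv] at hvs
          have hlt : m < m' := lt_of_le_of_ne hm' (by rintro rfl; simp [hvm] at hvm')
          exact (min_le_left _ _).trans (h2 m m' le_rfl hlt _ hus _ hvs)
      refine ⟨min ε₁ (min ε₂ δ), lt_min hε₁ (lt_min hε₂ hδ), fun z' hz' => ?_⟩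
      by_cases ht : truncNat z' m = truncNat z m
      · refine (min_le_right _ _).trans ?_
        cases hb : z m <;> cases hb' : z' m
        · exact (hz' (by rw [truncNat_succ_of_false hb, truncNat_succ_of_false hb', ht])).elim
        · exact key z' z ht rfl hb' hb
        · rw [dist_comm]; exact key z z' rfl ht hb hb'
        · exact (hz' (by rw [truncNat_succ_of_true hb, truncNat_succ_of_true hb', ht])).elim
      · exact (min_le_left _ _).trans (h1 z' ht)
  refine ⟨φ, hφ, fun z hz => ?_, fun k => ?_, hsep⟩
  · refine Metric.continuousAt_iff'.2 fun ε hε => ?_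
    obtain ⟨m, hm⟩ := exists_pow_lt_of_lt_one hε (show (1 / 2 : ℝ) < 1 by norm_num)
    obtain ⟨m', hm', hzm⟩ := exists_true_of_notMem hz m
    filter_upwards [setOf_truncNat_mem_nhds z (m' + 1)] with z' hz'
    have h1 := hφF z (m' + 1)
    have h2 := hφF z' (m' + 1)
    rw [show truncNat z' (m' + 1) = truncNat z (m' + 1) from hz'] at h2
    rw [truncNat_succ_of_true hzm] at h1 h2
    exact ((hchild _ m' (truncNat_lt z m')).2 _ h2 _ h1).trans_lt
      ((pow_le_pow_of_le_one (by norm_num) (by norm_num) hm').trans_lt hm)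
  · obtain ⟨ε, hε, h1⟩ := hsep (bitSeq k) k
    obtain ⟨δ, hδ, h2⟩ := (hgood k).jump
    refine ⟨min ε δ, lt_min hε hδ, fun z hz => ?_⟩
    by_cases ht : truncNat z k = truncNat (bitSeq k) k
    · rw [truncNat_bitSeq Nat.lt_two_pow_self] at ht
      rcases hnext z k with hq | ⟨m', -, -, hs⟩
      · exact (hz (by rw [hq, ht])).elim
      · rw [ht] at hs
        rw [hφq]
        exact (min_le_right _ _).trans (h2 m' _ hs)
    · exact (min_le_left _ _).trans (h1 z ht)

end Compact

/-! ### Continuity of Lebesgue's function off the eventually zero sequences -/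

theorem exists_notMem_eventuallyZero (z : ℕ → Bool) (m : ℕ) :
    ∃ z' ∉ eventuallyZero, truncNat z' m = truncNat z m := by
  refine ⟨fun i => if i < m then z i else true, ?_, truncNat_eq_iff.2 fun i hi => if_pos hi⟩
  rintro ⟨i, hi⟩
  have := hi (max i m) (le_max_left _ _)
  simp at this

theorem lebesgueL_le {z : ℕ → Bool} (m : ℕ) : lebesgueL z ≤ 1 / (1 + (truncNat z m : ℝ)) := by
  by_cases hz : z ∈ eventuallyZero
  · obtain ⟨k, rfl⟩ := exists_eq_bitSeq hz
    rw [lebesgueL_bitSeq]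
    have h : truncNat (bitSeq k) m ≤ k := by
      have hmono : Monotone (truncNat (bitSeq k)) := monotone_nat_of_le_succ fun n => by
        simp only [truncNat]; split_ifs <;> simp
      refine (hmono (le_max_left m k)).trans (le_of_eq (truncNat_bitSeq ?_))
      exact Nat.lt_two_pow_self.trans_le (Nat.pow_le_pow_right (by norm_num) (le_max_right m k))
    exact one_div_le_one_div_of_le (by positivity) (by exact_mod_cast Nat.add_le_add_left h 1)
  · rw [lebesgueL_of_notMem hz]; positivity

theorem lebesgueL_nonneg (z : ℕ → Bool) : 0 ≤ lebesgueL z := by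
  rw [lebesgueL]; split_ifs <;> positivity

theorem continuousAt_lebesgueL {z : ℕ → Bool} (hz : z ∉ eventuallyZero) :
    ContinuousAt lebesgueL z := by
  refine Metric.continuousAt_iff'.2 fun ε hε => ?_
  obtain ⟨n, hn⟩ := exists_nat_one_div_lt hε
  obtain ⟨m, hm, hzm⟩ := exists_true_of_notMem hz n
  filter_upwards [setOf_truncNat_mem_nhds z (m + 1)] with z' hz'
  have h1 := lebesgueL_le (z := z') (m + 1)
  rw [show truncNat z' (m + 1) = truncNat z (m + 1) from hz', truncNat_succ_of_true hzm] at h1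
  have h2 : n ≤ truncNat z m + 2 ^ m := by
    have : m < 2 ^ m := Nat.lt_two_pow_self
    omega
  have h3 : 1 / (1 + ((truncNat z m + 2 ^ m : ℕ) : ℝ)) ≤ 1 / ((n : ℝ) + 1) :=
    one_div_le_one_div_of_le (by positivity) (by rw [add_comm]; exact_mod_cast Nat.add_le_add_left h2 1)
  rw [lebesgueL_of_notMem hz, Real.dist_eq, sub_zero, abs_of_nonneg (lebesgueL_nonneg z')]
  linarith

/-! ### Containment and the exclusion of both alternatives -/

section Containment

variable {X₀ Y₀ X₁ Y₁ : Type*} [TopologicalSpace X₀] [TopologicalSpace Y₀]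
  [TopologicalSpace X₁] [TopologicalSpace Y₁]

theorem FunContained.comp_isEmbedding {X₂ : Type*} [TopologicalSpace X₂] {f : X₀ → Y₀}
    {g : X₂ → Y₁} {θ : X₁ → X₂} (hθ : IsEmbedding θ) (h : FunContained f (g ∘ θ)) :
    FunContained f g := by
  obtain ⟨φ, ψ, hφ, hψ, he⟩ := h
  exact ⟨θ ∘ φ, ψ, hθ.comp hφ, hψ, he⟩

/-- When `f` and `g ∘ φ` are the same map `c` followed by embeddings `a` and `b`, the required `ψ`
is `b ∘ a⁻¹`. -/
theorem funContained_of_factor {W : Type*} [TopologicalSpace W] {f : X₀ → Y₀} {g : X₁ → Y₁}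
    {φ : X₀ → X₁} (hφ : IsEmbedding φ) {a : W → Y₀} (ha : IsEmbedding a) {b : W → Y₁}
    (hb : IsEmbedding b) (c : X₀ → W) (hf : ∀ x, f x = a (c x)) (hg : ∀ x, g (φ x) = b (c x)) :
    FunContained f g := by
  have hsub : range f ⊆ range a := by
    rintro _ ⟨x, rfl⟩
    exact ⟨c x, (hf x).symm⟩
  refine ⟨φ, b ∘ ha.toHomeomorph.symm ∘ inclusion hsub, hφ,
    hb.comp (ha.toHomeomorph.symm.isEmbedding.comp (IsEmbedding.inclusion hsub)), fun x => ?_⟩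
  have : ha.toHomeomorph.symm (inclusion hsub ⟨f x, mem_range_self x⟩) = c x := by
    rw [Homeomorph.symm_apply_eq]
    exact Subtype.ext (hf x)
  simp only [Function.comp_apply, this, hg]

/-- By Baire, one of the closed pieces, pulled back along `φ`, has interior; there `ψ ∘ f` is
continuous, and the embedding `ψ` can be cancelled. -/
theorem PiecewiseContinuous.exists_isOpen_continuousOn [Nonempty X₀] [BaireSpace X₀]
    {f : X₀ → Y₀} {g : X₁ → Y₁} (hg : PiecewiseContinuous g) (h : FunContained f g) :
    ∃ U : Set X₀, IsOpen U ∧ U.Nonempty ∧ ContinuousOn f U := by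
  obtain ⟨F, hF, hcov, hcont⟩ := hg
  obtain ⟨φ, ψ, hφ, hψ, he⟩ := h
  obtain ⟨n, hn⟩ := nonempty_interior_of_iUnion_of_closed (f := fun n => φ ⁻¹' F n)
    (fun n => (hF n).preimage hφ.continuous) (by rw [← preimage_iUnion, hcov, preimage_univ])
  refine ⟨_, isOpen_interior, hn, ?_⟩
  have h1 : ContinuousOn (g ∘ φ) (interior (φ ⁻¹' F n)) :=
    (hcont n).comp hφ.continuous.continuousOn fun x hx =>
      interior_subset (s := φ ⁻¹' F n) hx
  have h2 : g ∘ φ = ψ ∘ rangeFactorization f := funext fun x => (he x).symm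
  rw [h2, ← hψ.isInducing.continuousOn_iff] at h1
  exact continuous_subtype_val.comp_continuousOn h1

theorem not_continuousOn_lebesgueL {U : Set (ℕ → Bool)} (hU : IsOpen U) (hne : U.Nonempty) :
    ¬ ContinuousOn lebesgueL U := by
  intro hc
  obtain ⟨z, hz⟩ := hne
  obtain ⟨m, hm⟩ := exists_truncNat_subset_of_mem_nhds (hU.mem_nhds hz)
  have hq : bitSeq (truncNat z m) ∈ U := hm (truncNat_bitSeq (truncNat_lt z m))
  have hat := hc.continuousAt (hU.mem_nhds hq)
  have hpos : 0 < lebesgueL (bitSeq (truncNat z m)) := by rw [lebesgueL_bitSeq]; positivity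
  obtain ⟨n, hn⟩ := exists_truncNat_subset_of_mem_nhds (hat.eventually (lt_mem_nhds hpos))
  obtain ⟨w, hw, hwt⟩ := exists_notMem_eventuallyZero (bitSeq (truncNat z m)) n
  have h0 : 0 < lebesgueL w := hn hwt
  rw [lebesgueL_of_notMem hw] at h0
  exact lt_irrefl 0 h0

theorem PiecewiseContinuous.not_funContained {g : X₁ → Y₁} (hg : PiecewiseContinuous g) :
    ¬ (FunContained lebesgueL g ∨ FunContained lebesgueL₁ g) := by
  rintro (h | h)
  · obtain ⟨U, hU, hne, hc⟩ := hg.exists_isOpen_continuousOn h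
    exact not_continuousOn_lebesgueL hU hne hc
  · obtain ⟨U, hU, hne, hc⟩ := hg.exists_isOpen_continuousOn h
    exact not_continuousOn_lebesgueL hU hne (continuous_snd.comp_continuousOn hc)

end Containment

/-! ### Copies of `L` and `L₁` -/

section Cantor

theorem OnePoint.isEmbedding_elim_of_tendsto {Y : Type*} [TopologicalSpace Y] [T2Space Y]
    {u : ℕ → Y} {y : Y} (hu : Function.Injective u) (hy : ∀ k, u k ≠ y)
    (hlim : Filter.Tendsto u Filter.atTop (𝓝 y)) :
    IsEmbedding (fun p : OnePoint ℕ => p.elim y u) := by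
  have hc : Continuous (fun p : OnePoint ℕ => p.elim y u) :=
    (OnePoint.continuous_iff_from_nat _).2 hlim
  refine (hc.isClosedEmbedding ?_).isEmbedding
  intro p q hpq
  induction p using OnePoint.rec with
  | infty =>
    induction q using OnePoint.rec with
    | infty => rfl
    | coe l => exact (hy l hpq.symm).elim
  | coe k =>
    induction q using OnePoint.rec with
    | infty => exact (hy k hpq).elim
    | coe l => exact congrArg _ (hu hpq)

/-- Both images are a sequence of distinct points together with its limit, i.e. copies of `OnePoint
ℕ`. -/
theorem funContained_lebesgueL {X Y : Type*} [TopologicalSpace X] [TopologicalSpace Y] [T2Space Y]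
    {f : X → Y} {φ : (ℕ → Bool) → X} (hφ : IsEmbedding φ) {y : Y}
    (h0 : ∀ z ∉ eventuallyZero, f (φ z) = y) (hy : ∀ k, f (φ (bitSeq k)) ≠ y)
    (hinj : Function.Injective fun k => f (φ (bitSeq k)))
    (hlim : Filter.Tendsto (fun k => f (φ (bitSeq k))) Filter.atTop (𝓝 y)) :
    FunContained lebesgueL f := by
  classical
  have hL : IsEmbedding (fun p : OnePoint ℕ => p.elim (0 : ℝ) fun k => 1 / (1 + (k : ℝ))) := by
    refine OnePoint.isEmbedding_elim_of_tendsto (fun k l h => ?_) (fun k => by positivity) ?_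
    · simpa using h
    · simpa [add_comm] using tendsto_one_div_add_atTop_nhds_zero_nat (𝕜 := ℝ)
  have hc : ∀ z, ∃ p : OnePoint ℕ, lebesgueL z = p.elim (0 : ℝ) (fun k => 1 / (1 + (k : ℝ))) ∧
      f (φ z) = p.elim y fun k => f (φ (bitSeq k)) := by
    intro z
    by_cases hz : z ∈ eventuallyZero
    · obtain ⟨k, rfl⟩ := exists_eq_bitSeq hz
      exact ⟨(k : OnePoint ℕ), lebesgueL_bitSeq k, rfl⟩
    · exact ⟨OnePoint.infty, lebesgueL_of_notMem hz, h0 z hz⟩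
  choose c hcL hcf using hc
  exact funContained_of_factor hφ hL (OnePoint.isEmbedding_elim_of_tendsto hinj hy hlim) c hcL hcf

/-- The range of `L₁` refines the Cantor topology by isolating the eventually zero sequences. The
hypotheses say that `z ↦ f (φ z)` induces this topology: `hcont` gives continuity, `hiso` and `hsep`
that of the inverse. -/
theorem funContained_lebesgueL₁ {X Y : Type*} [TopologicalSpace X] [MetricSpace Y]
    {f : X → Y} {φ : (ℕ → Bool) → X} (hφ : IsEmbedding φ)
    (hcont : ∀ z ∉ eventuallyZero, ContinuousAt (f ∘ φ) z)
    (hiso : ∀ k, ∃ ε > 0, ∀ z, z ≠ bitSeq k → ε ≤ dist (f (φ z)) (f (φ (bitSeq k))))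
    (hsep : ∀ z m, ∃ ε > 0, ∀ z', truncNat z' m ≠ truncNat z m →
      ε ≤ dist (f (φ z')) (f (φ z))) :
    FunContained lebesgueL₁ f := by
  refine funContained_of_factor (W := range lebesgueL₁) hφ IsEmbedding.subtypeVal
    (b := fun p => f (φ p.1.1)) ?_ (rangeFactorization lebesgueL₁) (fun z => rfl) fun z => rfl
  refine ⟨isInducing_iff_nhds.2 ?_, ?_⟩
  · rintro ⟨_, z, rfl⟩
    refine le_antisymm ?_ ?_
    · rw [← Filter.tendsto_iff_comap]
      by_cases hz : z ∈ eventuallyZero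
      · obtain ⟨k, rfl⟩ := exists_eq_bitSeq hz
        -- A value above `1 / (k + 2)` forces `w = bitSeq l` with `l ≤ k`; both numbers lie below `2
        -- ^ k`, so agreement of the first `k` digits gives `l = k`.
        have hev : ∀ᶠ p : range lebesgueL₁ in 𝓝 ⟨lebesgueL₁ (bitSeq k), mem_range_self _⟩,
            p = ⟨lebesgueL₁ (bitSeq k), mem_range_self _⟩ := by
          have h1 : ∀ᶠ p : range lebesgueL₁ in 𝓝 ⟨lebesgueL₁ (bitSeq k), mem_range_self _⟩,
              truncNat p.1.1 k = truncNat (bitSeq k) k :=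
            ((isOpen_setOf_truncNat_eq k _).preimage
              (continuous_fst.comp continuous_subtype_val)).mem_nhds rfl
          have h2 : ∀ᶠ p : range lebesgueL₁ in 𝓝 ⟨lebesgueL₁ (bitSeq k), mem_range_self _⟩,
              1 / (1 + ((k + 1 : ℕ) : ℝ)) < p.1.2 := by
            refine (continuous_snd.comp continuous_subtype_val).continuousAt.eventually
              (lt_mem_nhds ?_)
            change 1 / (1 + ((k + 1 : ℕ) : ℝ)) < lebesgueL (bitSeq k)
            rw [lebesgueL_bitSeq]
            exact one_div_lt_one_div_of_lt (by positivity) (by push_cast; linarith)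
          filter_upwards [h1, h2]
          rintro ⟨_, w, rfl⟩ hw1 hw2
          change truncNat w k = truncNat (bitSeq k) k at hw1
          change _ < lebesgueL w at hw2
          have hw : w ∈ eventuallyZero := by
            by_contra hw
            rw [lebesgueL_of_notMem hw] at hw2
            exact hw2.not_gt (by positivity)
          obtain ⟨l, rfl⟩ := exists_eq_bitSeq hw
          rw [lebesgueL_bitSeq] at hw2
          have hl : l < k + 1 := by
            have := lt_of_one_div_lt_one_div (by positivity) hw2
            exact_mod_cast lt_of_add_lt_add_left this
          have hk : k < 2 ^ k := Nat.lt_two_pow_self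
          rw [truncNat_bitSeq hk, truncNat_bitSeq (by omega)] at hw1
          rw [hw1]
        exact (tendsto_const_nhds).congr' (hev.mono fun p hp => by rw [hp])
      · exact (hcont z hz).tendsto.comp
          ((continuous_fst.comp continuous_subtype_val).tendsto (⟨lebesgueL₁ z, mem_range_self z⟩ : range lebesgueL₁))
    · intro U hU
      by_cases hz : z ∈ eventuallyZero
      · obtain ⟨k, rfl⟩ := exists_eq_bitSeq hz
        obtain ⟨ε, hε, h⟩ := hiso k
        refine ⟨Metric.ball _ ε, Metric.ball_mem_nhds _ hε, ?_⟩
        rintro ⟨_, w, rfl⟩ hw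
        have hwk : w = bitSeq k := by
          by_contra hne
          exact (h w hne).not_gt hw
        subst hwk
        exact mem_of_mem_nhds hU
      · have hL1 : ContinuousAt lebesgueL₁ z := continuousAt_id.prodMk (continuousAt_lebesgueL hz)
        obtain ⟨V, hV, hVU⟩ := mem_nhds_subtype _ _ _ |>.1 hU
        obtain ⟨m, hm⟩ := exists_truncNat_subset_of_mem_nhds (hL1 hV)
        obtain ⟨ε, hε, h⟩ := hsep z m
        refine ⟨Metric.ball _ ε, Metric.ball_mem_nhds _ hε, ?_⟩
        rintro ⟨_, w, rfl⟩ hw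
        refine hVU (hm ?_)
        by_contra hne
        exact (h w hne).not_gt hw
  · rintro ⟨_, z, rfl⟩ ⟨_, w, rfl⟩ hzw
    by_contra hne
    have hzw' : z ≠ w := fun h => hne (by rw [h])
    obtain ⟨i, hi⟩ := Function.ne_iff.1 hzw'
    obtain ⟨ε, hε, h⟩ := hsep z (i + 1)
    have h1 := h w fun ht => hi (truncNat_eq_iff.1 ht i (Nat.lt_succ_self i)).symm
    have h2 : f (φ w) = f (φ z) := hzw.symm
    rw [h2, dist_self] at h1
    exact hε.not_ge h1

theorem neBot_nhdsNE_cantor (z : ℕ → Bool) : (𝓝[≠] z).NeBot := by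
  refine mem_closure_iff_nhdsWithin_neBot.1 (mem_closure_iff_nhds.2 fun U hU => ?_)
  obtain ⟨m, hm⟩ := exists_truncNat_subset_of_mem_nhds hU
  refine ⟨Function.update z m (!z m), hm (truncNat_eq_iff.2 fun i hi => ?_), fun h => ?_⟩
  · exact Function.update_of_ne hi.ne _ _
  · have := congrFun (mem_singleton_iff.1 h) m
    simp at this

theorem funContained_lebesgue_of_hasJumps {Y : Type*} [MetricSpace Y] {g : (ℕ → Bool) → Y}
    (hg : Sigma02Measurable g) (hJ : HasJumpsAtBitSeq g) :
    FunContained lebesgueL g ∨ FunContained lebesgueL₁ g := by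
  let : MetricSpace (ℕ → Bool) := TopologicalSpace.metrizableSpaceMetric (ℕ → Bool)
  have hp := neBot_nhdsNE_cantor
  have hC := hg.dense_continuousAt
  have hJd : Dense {x | HasJumpAt g x} := by
    refine fun z => mem_closure_iff_nhds.2 fun U hU => ?_
    obtain ⟨m, hm⟩ := exists_truncNat_subset_of_mem_nhds hU
    refine ⟨bitSeq (truncNat z m), hm (truncNat_bitSeq (truncNat_lt z m)), ?_⟩
    obtain ⟨δ, hδ, n, h⟩ := hJ (truncNat z m)
    refine ⟨δ, hδ, ?_⟩
    filter_upwards [mem_nhdsWithin_of_mem_nhds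
      (setOf_truncNat_mem_nhds (bitSeq (truncNat z m)) n), self_mem_nhdsWithin] with w hw hne
    exact h w hw hne
  by_cases hI : ∃ O : Set (ℕ → Bool), IsOpen O ∧ O.Nonempty ∧ ∃ y, ∀ O' ⊆ O, IsOpen O' →
      O'.Nonempty → ∀ ε > 0, ∃ z ∈ O', dist (g z) y < ε
  · obtain ⟨O, hO, hne, y, hy⟩ := hI
    obtain ⟨φ, hφ, h0, h1, h2, h3⟩ := exists_embedding_of_concentrated hC hJd hO hne hy
    exact Or.inl (funContained_lebesgueL hφ h0 h1 h2 h3)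
  · push Not at hI
    obtain ⟨φ, hφ, h1, h2, h3⟩ := exists_embedding_of_separated hC hJd hI
    exact Or.inr (funContained_lebesgueL₁ hφ h1 h2 h3)

end Cantor

theorem theorem6 {X : Type*} {Y : Type*} [MetricSpace X] (hX : IsAbsoluteSouslinF X)
    [TopologicalSpace Y] [TopologicalSpace.MetrizableSpace Y]
    (f : X → Y) (hf : Sigma02Measurable f) :
    (PiecewiseContinuous f ∨ (FunContained lebesgueL f ∨ FunContained lebesgueL₁ f)) ∧
      ¬ (PiecewiseContinuous f ∧ (FunContained lebesgueL f ∨ FunContained lebesgueL₁ f)) := by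
  let : MetricSpace Y := TopologicalSpace.metrizableSpaceMetric Y
  refine ⟨or_iff_not_imp_left.2 fun hpc => ?_, fun h => h.1.not_funContained h.2⟩
  obtain ⟨φ, hφ, hJ⟩ := exists_embedding_hasJumpsAtBitSeq hX hf hpc
  exact (funContained_lebesgue_of_hasJumps (hf.comp_continuous hφ.continuous) hJ).imp
    (fun h => h.comp_isEmbedding hφ) fun h => h.comp_isEmbedding hφ
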